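/- Let $A$ be a finite-dimensional semisimple unital associative algebra over $\mathbb R$ and let $\sigma:A\to A$ be an anti-involution, i.e. an $\mathbb R$-linear map with $\sigma(ab)=\sigma(b)\sigma(a)$ and $\sigma^2=\mathrm{Id}$. Put $A^\sigma=\{a\in A:\sigma(a)=a\}$ and $A^\sigma_{\ge 0}=\{b^2: b\in A^\sigma\}$. Assume that $(A,\sigma)$ is Hermitian: for all $x,y\in A^\sigma$, $x^2+y^2=0$ implies $x=y=0$. For a matrix $\Omega\in \mathrm{Mat}_2(A)$ let $\omega(x,y)=\sigma(x)^t\,\Omega\, y$ on the right $A$-module $A^2$, let $\mathrm{Aut}(\omega)\subseteq \mathrm{GL}_2(A)$ be the group of $A$-linear automorphisms preserving $\omega$; its Lie algebra is $\{X\in\mathrm{Mat}_2(A):\omega(Xx,y)+\omega(x,Xy)=0\ \ \forall x,y\}$. Let $\mathrm{Sp}_2(A,\sigma)$ and $\mathrm{O}_{(1,1)}(A,\sigma)$ be the groups $\mathrm{Aut}(\omega)$ for $\Omega=\begin{pmatrix}0&1\\-1&0\end{pmatrix}$ and $\Omega=\begin{pmatrix}0&1\\1&0\end{pmatrix}$ respectively.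 For $G$ either of these groups, with Lie algebra $\mathfrak g$, let $K=\{g\in G:\sigma(g)^tg=1\}$ and $\theta(X)=-\sigma(X)^t$ for $X\in\mathfrak g$. The triple $(G,K,\theta)$ is called real reductive if $\mathfrak g$ is a reductive Lie algebra, $K$ is a maximal compact subgroup of $G$, $\theta$ is an involutive automorphism of $\mathfrak g$ whose $+1$-eigenspace is $\mathfrak k=\mathrm{Lie}(K)$, and, with $\mathfrak m$ the $-1$-eigenspace, there is a nondegenerate symmetric $\mathrm{Ad}(G)$- and $\theta$-invariant bilinear form on $\mathfrak g$ which is negative definite on $\mathfrak k$, positive definite on $\mathfrak m$ and for which $\mathfrak k\perp\mathfrak m$, and $K\times\mathfrak m\to G$, $(k,X)\mapsto k\exp(X)$, is a diffeomorphism. A real reductive $(G,K,\theta)$ is called strongly reductive if $G$ acts by inner automorphisms on $\mathfrak g^{\mathbb C}=\mathfrak g\otimes_{\mathbb R}\mathbb C$ via the adjoint representation, i.e. for every $g\in G$ the $\mathbb{C}$-linear extension of $\mathrm{Ad}(g)$ lies in the group generated by all $\exp(\mathrm{ad}\,Z)$, $Z\in\mathfrak g^{\mathbb C}$. Then: 1.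 If the action of $A^\times$ on $A$ by congruence, $x\mapsto a x\sigma(a)$, preserves $A^\sigma_{\ge0}$, then $\mathrm{Sp}_2(A,\sigma)$ is strongly reductive. 2. If $A^\times$ is connected, then $\mathrm{O}_{(1,1)}(A,\sigma)$ is strongly reductive. -/

import Mathlib

open scoped Matrix Matrix.Norms.Operator TensorProduct ContDiff

attribute [local instance] LieRing.ofAssociativeRing

noncomputable section

/-! ### Involutive algebras -/

/-- `σ` is an anti-involution of the real algebra `A`. -/
structure IsAntiInvolution {A : Type*} [Ring A] [Algebra ℝ A] (σ : A →ₗ[ℝ] A) : Prop where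
  map_mul : ∀ a b : A, σ (a * b) = σ b * σ a
  involutive : ∀ a : A, σ (σ a) = a

/-- The defining condition of a Hermitian anti-involution: for `σ`-symmetric `x`, `y`,
`x² + y² = 0` implies `x = y = 0`. -/
def IsHermitianInvolution {A : Type*} [Ring A] [Algebra ℝ A] (σ : A →ₗ[ℝ] A) : Prop :=
  ∀ x y : A, σ x = x → σ y = y → x ^ 2 + y ^ 2 = 0 → x = 0 ∧ y = 0

/-- The set of `σ`-non-negative elements: the squares of `σ`-symmetric elements. -/
def nonnegElements {A : Type*} [Ring A] [Algebra ℝ A] (σ : A →ₗ[ℝ] A) : Set A :=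
  {x | ∃ b : A, σ b = b ∧ x = b ^ 2}

/-! ### Closed linear groups, reductive and strongly reductive groups

`R` is a finite-dimensional real algebra; a linear group is a closed subgroup of `Rˣ`. -/

/-- A closed subgroup of `Rˣ` together with its Lie algebra, the set of all `X` such that
`exp (t X)` lies in the group for all real `t`. -/
structure ClosedLinearGroup (R : Type*) [NormedRing R] [NormedAlgebra ℝ R] where
  group : Subgroup Rˣ
  isClosed_group : IsClosed (group : Set Rˣ)
  lie : LieSubalgebra ℝ R
  mem_lie_iff : ∀ X : R, X ∈ lie ↔
    ∀ t : ℝ, ∃ g ∈ group, (g : R) = NormedSpace.exp (t • X)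

namespace ClosedLinearGroup

variable {R : Type*} [NormedRing R] [NormedAlgebra ℝ R] [FiniteDimensional ℝ R]

theorem conj_mem (G : ClosedLinearGroup R) {g : Rˣ} (hg : g ∈ G.group) {X : R}
    (hX : X ∈ G.lie) : (g : R) * X * (↑g⁻¹ : R) ∈ G.lie := by
  rw [G.mem_lie_iff] at hX ⊢
  intro t
  obtain ⟨h, hh, e⟩ := hX t
  refine ⟨g * h * g⁻¹, G.group.mul_mem (G.group.mul_mem hg hh) (G.group.inv_mem hg), ?_⟩
  let _ : NormedAlgebra ℚ R := NormedAlgebra.restrictScalars ℚ ℝ R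
  have : CompleteSpace R := FiniteDimensional.complete ℝ R
  have := NormedSpace.exp_units_conj (𝔸 := R) g (t • X)
  simp only [Units.val_mul, e]
  rw [← this]
  congr 1
  simp

/-- The adjoint action `X ↦ g X g⁻¹` of `G` on its Lie algebra. -/
def Ad (G : ClosedLinearGroup R) (g : G.group) : G.lie ≃ₗ[ℝ] G.lie where
  toFun X := ⟨(g.1 : R) * X.1 * (↑g.1⁻¹ : R), G.conj_mem g.2 X.2⟩
  invFun X := ⟨(↑g.1⁻¹ : R) * X.1 * (g.1 : R), by
    simpa using G.conj_mem (G.group.inv_mem g.2) X.2⟩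
  map_add' X Y := by ext; simp [mul_add, add_mul]
  map_smul' c X := by ext; simp
  left_inv X := by ext; simp [mul_assoc]
  right_inv X := by ext; simp [mul_assoc]

end ClosedLinearGroup

/-- `φ = exp f` for endomorphisms of a finite-dimensional complex vector space: the exponential
series of `f` converges to `φ` (tested on vectors and linear functionals). -/
def IsExpOf {V : Type*} [AddCommGroup V] [Module ℂ V] (f φ : Module.End ℂ V) : Prop :=
  ∀ (v : V) (l : Module.Dual ℂ V),
    HasSum (fun n : ℕ => (Nat.factorial n : ℂ)⁻¹ * l ((f ^ n) v)) (l (φ v))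

/-- The group `Int L` of inner automorphisms of a finite-dimensional complex Lie algebra: the
group generated by all `exp (ad x)`. -/
def innerAutGroup (L : Type*) [LieRing L] [LieAlgebra ℂ L] : Subgroup (L ≃ₗ[ℂ] L) :=
  Subgroup.closure {φ | ∃ x : L, IsExpOf (LieAlgebra.ad ℂ L x) (φ : L →ₗ[ℂ] L)}

/-- `(G, K, θ)` is a real reductive group: the Lie algebra is reductive, `K` is a maximal compact
subgroup, `θ` is an involution of the Lie algebra with fixed algebra `𝔨 = Lie K` and
`(-1)`-eigenspace `𝔪`, there is an `Ad G`- and `θ`-invariant nondegenerate symmetric bilinear form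
that is negative definite on `𝔨`, positive definite on `𝔪` and makes `𝔨` and `𝔪` orthogonal, and
`(k, X) ↦ k exp X` is a diffeomorphism from `K × 𝔪` onto `G`. -/
structure IsRealReductive {R : Type*} [NormedRing R] [NormedAlgebra ℝ R] [FiniteDimensional ℝ R]
    (G : ClosedLinearGroup R) (K : Subgroup Rˣ) (θ : R →ₗ[ℝ] R) : Prop where
  reductive : LieAlgebra.HasCentralRadical ℝ G.lie
  le_group : K ≤ G.group
  isCompact : IsCompact (K : Set Rˣ)
  maximal : ∀ K' : Subgroup Rˣ, K ≤ K' → K' ≤ G.group → IsCompact (K' : Set Rˣ) → K' = K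
  map_mem : ∀ X ∈ G.lie, θ X ∈ G.lie
  involutive : ∀ X ∈ G.lie, θ (θ X) = X
  map_lie : ∀ X ∈ G.lie, ∀ Y ∈ G.lie, θ ⁅X, Y⁆ = ⁅θ X, θ Y⁆
  fixed_iff : ∀ X ∈ G.lie, θ X = X ↔ ∀ t : ℝ, ∃ k ∈ K, (k : R) = NormedSpace.exp (t • X)
  exists_form : ∃ B : LinearMap.BilinForm ℝ G.lie, B.Nondegenerate ∧ B.IsSymm ∧
    (∀ (g : G.group) (X Y : G.lie), B (G.Ad g X) (G.Ad g Y) = B X Y) ∧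
    (∀ X Y X' Y' : G.lie, (X' : R) = θ X → (Y' : R) = θ Y → B X' Y' = B X Y) ∧
    (∀ X : G.lie, θ X = X → X ≠ 0 → B X X < 0) ∧
    (∀ X : G.lie, θ X = -X → X ≠ 0 → 0 < B X X) ∧
    (∀ X Y : G.lie, θ X = X → θ Y = -Y → B X Y = 0)
  polar_surjective : ∀ g ∈ G.group, ∃ k ∈ K, ∃ X ∈ G.lie, θ X = -X ∧
    (g : R) = k * NormedSpace.exp X
  /-- The polar map is injective, and the component `X` of its inverse is the restriction to `G`
  of a smooth map on an open set (hence so is the component `k = g exp (-X)`). -/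
  polar_smooth_inverse : ∃ (U : Set R) (f : R → R), IsOpen U ∧ ContDiffOn ℝ ∞ f U ∧
    (∀ g ∈ G.group, (g : R) ∈ U) ∧
    ∀ k ∈ K, ∀ X ∈ G.lie, θ X = -X → f (k * NormedSpace.exp X) = X

/-- A real reductive group `(G, K, θ)` is strongly reductive if `G` acts by inner automorphisms on
the complexification of its Lie algebra via the adjoint representation. -/
structure IsStronglyReductive {R : Type*} [NormedRing R] [NormedAlgebra ℝ R] [FiniteDimensional ℝ R]
    (G : ClosedLinearGroup R) (K : Subgroup Rˣ) (θ : R →ₗ[ℝ] R) : Prop where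
  isRealReductive : IsRealReductive G K θ
  inner : ∀ g : G.group,
    LinearEquiv.baseChange ℝ ℂ G.lie G.lie (G.Ad g) ∈ innerAutGroup (ℂ ⊗[ℝ] G.lie)

/-! ### Symmetry groups of sesquilinear forms on `A²` -/

section Forms

variable {A : Type*} [NormedRing A] [NormedAlgebra ℝ A]

/-- The `σ`-sesquilinear form `ω(x, y) = σ(x)ᵗ Ω y` on `A²`. -/
def sesqForm (σ : A →ₗ[ℝ] A) (Ω : Matrix (Fin 2) (Fin 2) A) :
    (Fin 2 → A) →ₗ[ℝ] (Fin 2 → A) →ₗ[ℝ] A :=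
  LinearMap.mk₂ ℝ (fun x y => (fun i => σ (x i)) ⬝ᵥ (Ω *ᵥ y))
    (fun x x' y => by simp only [Pi.add_apply, map_add]; exact add_dotProduct _ _ _)
    (fun c x y => by
      simp only [Pi.smul_apply, map_smul]
      exact smul_dotProduct c (fun i => σ (x i)) (Ω *ᵥ y))
    (fun x y y' => by rw [Matrix.mulVec_add, dotProduct_add])
    (fun c x y => by rw [Matrix.mulVec_smul, dotProduct_smul])

/-- `Aut(ω)`, a subgroup of `GL₂(A)` (the automorphisms of the right `A`-module `A²`). -/
def autGroup (σ : A →ₗ[ℝ] A) (Ω : Matrix (Fin 2) (Fin 2) A) :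
    Subgroup (Matrix (Fin 2) (Fin 2) A)ˣ where
  carrier := {g | ∀ x y : Fin 2 → A,
    sesqForm σ Ω ((g : Matrix (Fin 2) (Fin 2) A) *ᵥ x) ((g : Matrix (Fin 2) (Fin 2) A) *ᵥ y) =
      sesqForm σ Ω x y}
  one_mem' := by intro x y; rw [Units.val_one, Matrix.one_mulVec, Matrix.one_mulVec]
  mul_mem' := by
    intro g h hg hh x y
    rw [Units.val_mul, ← Matrix.mulVec_mulVec, ← Matrix.mulVec_mulVec, hg, hh]
  inv_mem' := by
    intro g hg x y
    rw [← hg, Matrix.mulVec_mulVec, Matrix.mulVec_mulVec, Units.mul_inv, Matrix.one_mulVec,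
      Matrix.one_mulVec]

/-- `End(ω)`, the Lie algebra of all `X` with `ω(X x, y) + ω(x, X y) = 0`. -/
def endLie (σ : A →ₗ[ℝ] A) (Ω : Matrix (Fin 2) (Fin 2) A) :
    LieSubalgebra ℝ (Matrix (Fin 2) (Fin 2) A) where
  carrier := {X | ∀ x y : Fin 2 → A,
    sesqForm σ Ω (X *ᵥ x) y + sesqForm σ Ω x (X *ᵥ y) = 0}
  zero_mem' := by
    intro x y
    rw [Matrix.zero_mulVec, Matrix.zero_mulVec, map_zero, map_zero, LinearMap.zero_apply, add_zero]
  add_mem' := by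
    intro X Y hX hY x y
    have h1 := hX x y
    have h2 := hY x y
    rw [Matrix.add_mulVec, Matrix.add_mulVec, map_add, map_add, LinearMap.add_apply,
      add_add_add_comm, h1, h2, add_zero]
  smul_mem' := by
    intro c X hX x y
    have h1 := hX x y
    rw [Matrix.smul_mulVec, Matrix.smul_mulVec, map_smul, map_smul, LinearMap.smul_apply,
      ← smul_add, h1, smul_zero]
  lie_mem' := by
    intro X Y hX hY x y
    have h1 := hX (Y *ᵥ x) y
    have h2 := hY x (X *ᵥ y)
    have h3 := hY (X *ᵥ x) y
    have h4 := hX x (Y *ᵥ y)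
    rw [Ring.lie_def, Matrix.sub_mulVec, Matrix.sub_mulVec, ← Matrix.mulVec_mulVec,
      ← Matrix.mulVec_mulVec, ← Matrix.mulVec_mulVec, ← Matrix.mulVec_mulVec, map_sub, map_sub,
      LinearMap.sub_apply, eq_neg_of_add_eq_zero_left h1, eq_neg_of_add_eq_zero_left h3,
      eq_neg_of_add_eq_zero_left h4, eq_neg_of_add_eq_zero_left h2]
    abel

variable [FiniteDimensional ℝ A]

/-- The real-bilinear map `(M, N) ↦ ω(M x, N y)`. -/
def sesqFormMat (σ : A →ₗ[ℝ] A) (Ω : Matrix (Fin 2) (Fin 2) A) (x y : Fin 2 → A) :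
    Matrix (Fin 2) (Fin 2) A →L[ℝ] Matrix (Fin 2) (Fin 2) A →L[ℝ] A :=
  LinearMap.toContinuousBilinearMap
    ((sesqForm σ Ω).compl₁₂ ((Matrix.mulVecBilin ℝ ℝ).flip x) ((Matrix.mulVecBilin ℝ ℝ).flip y))

theorem isClosed_autGroup (σ : A →ₗ[ℝ] A) (Ω : Matrix (Fin 2) (Fin 2) A) :
    IsClosed (autGroup σ Ω : Set (Matrix (Fin 2) (Fin 2) A)ˣ) := by
  have : (autGroup σ Ω : Set (Matrix (Fin 2) (Fin 2) A)ˣ) =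
      ⋂ x : Fin 2 → A, ⋂ y : Fin 2 → A, {g : (Matrix (Fin 2) (Fin 2) A)ˣ |
        sesqFormMat σ Ω x y g g = sesqForm σ Ω x y} := by
    ext g
    simp only [Set.mem_iInter]
    rfl
  rw [this]
  refine isClosed_iInter fun x => isClosed_iInter fun y => isClosed_eq ?_ continuous_const
  have h : Continuous fun g : (Matrix (Fin 2) (Fin 2) A)ˣ => (g : Matrix (Fin 2) (Fin 2) A) :=
    Units.continuous_val
  fun_prop

theorem mem_endLie_iff (σ : A →ₗ[ℝ] A) (Ω X : Matrix (Fin 2) (Fin 2) A) :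
    X ∈ endLie σ Ω ↔ ∀ t : ℝ, ∃ g ∈ autGroup σ Ω,
      (g : Matrix (Fin 2) (Fin 2) A) = NormedSpace.exp (t • X) := by
  have : CompleteSpace (Matrix (Fin 2) (Fin 2) A) := FiniteDimensional.complete ℝ _
  let _ : NormedAlgebra ℚ (Matrix (Fin 2) (Fin 2) A) := NormedAlgebra.restrictScalars ℚ ℝ _
  have hd : ∀ (x y : Fin 2 → A) (t : ℝ), HasDerivAt
      (fun t : ℝ => sesqFormMat σ Ω x y (NormedSpace.exp (t • X)) (NormedSpace.exp (t • X)))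
      (sesqFormMat σ Ω x y (NormedSpace.exp (t • X)) (X * NormedSpace.exp (t • X)) +
        sesqFormMat σ Ω x y (X * NormedSpace.exp (t • X)) (NormedSpace.exp (t • X))) t := by
    intro x y t
    exact (sesqFormMat σ Ω x y).hasDerivAt_of_bilinear
      (fun _ => hasDerivAt_exp_smul_const' X t) (fun _ => hasDerivAt_exp_smul_const' X t)
  constructor
  · intro hX t
    have hu : IsUnit (NormedSpace.exp (t • X)) := NormedSpace.isUnit_exp _
    refine ⟨hu.unit, ?_, rfl⟩
    intro x y
    have hz : ∀ s : ℝ, sesqFormMat σ Ω x y (NormedSpace.exp (s • X))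
        (X * NormedSpace.exp (s • X)) + sesqFormMat σ Ω x y (X * NormedSpace.exp (s • X))
        (NormedSpace.exp (s • X)) = 0 := by
      intro s
      have h := hX (NormedSpace.exp (s • X) *ᵥ x) (NormedSpace.exp (s • X) *ᵥ y)
      rw [Matrix.mulVec_mulVec, Matrix.mulVec_mulVec] at h
      rw [add_comm]
      exact h
    have hc := is_const_of_deriv_eq_zero (fun s => (hd x y s).differentiableAt)
      (fun s => by rw [(hd x y s).deriv, hz s]) t 0
    simp only [zero_smul, NormedSpace.exp_zero] at hc
    refine Eq.trans hc ?_
    change sesqForm σ Ω (1 *ᵥ x) (1 *ᵥ y) = _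
    rw [Matrix.one_mulVec, Matrix.one_mulVec]
  · intro h x y
    have hc : (fun t : ℝ => sesqFormMat σ Ω x y (NormedSpace.exp (t • X))
        (NormedSpace.exp (t • X))) = fun _ => sesqForm σ Ω x y := by
      funext t
      obtain ⟨g, hg, e⟩ := h t
      rw [← e]
      exact hg x y
    have h0 := hd x y 0
    rw [hc] at h0
    have h1 := h0.unique (hasDerivAt_const (0 : ℝ) _)
    simp only [zero_smul, NormedSpace.exp_zero, mul_one] at h1
    rw [add_comm] at h1
    have h2 : sesqForm σ Ω (X *ᵥ x) (1 *ᵥ y) + sesqForm σ Ω (1 *ᵥ x) (X *ᵥ y) = 0 := h1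
    rwa [Matrix.one_mulVec, Matrix.one_mulVec] at h2

/-- `Aut(ω)` as a closed linear group with Lie algebra `End(ω)`. -/
def formGroup (σ : A →ₗ[ℝ] A) (Ω : Matrix (Fin 2) (Fin 2) A) :
    ClosedLinearGroup (Matrix (Fin 2) (Fin 2) A) where
  group := autGroup σ Ω
  isClosed_group := isClosed_autGroup σ Ω
  lie := endLie σ Ω
  mem_lie_iff := mem_endLie_iff σ Ω

/-- The symplectic group `Sp₂(A, σ)`. -/
def Sp2 (σ : A →ₗ[ℝ] A) : ClosedLinearGroup (Matrix (Fin 2) (Fin 2) A) :=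
  formGroup σ !![0, 1; -1, 0]

/-- The indefinite orthogonal group `O₍₁,₁₎(A, σ)`. -/
def O11 (σ : A →ₗ[ℝ] A) : ClosedLinearGroup (Matrix (Fin 2) (Fin 2) A) :=
  formGroup σ !![0, 1; 1, 0]

/-- The group `O₂(A, σ)` of all `g` with `σ(g)ᵗ g = 1`, that is, the symmetry group of the form
with `Ω = 1`. -/
def O2 (σ : A →ₗ[ℝ] A) : Subgroup (Matrix (Fin 2) (Fin 2) A)ˣ :=
  autGroup σ 1

/-- The Cartan involution `X ↦ -σ(X)ᵗ`. -/
def cartanInvolution (σ : A →ₗ[ℝ] A) :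
    Matrix (Fin 2) (Fin 2) A →ₗ[ℝ] Matrix (Fin 2) (Fin 2) A where
  toFun X := -(X.map σ)ᵀ
  map_add' X Y := by
    ext i j
    simp only [Matrix.neg_apply, Matrix.transpose_apply, Matrix.map_apply, Matrix.add_apply,
      map_add, neg_add]
  map_smul' c X := by
    ext i j
    simp only [Matrix.neg_apply, Matrix.transpose_apply, Matrix.map_apply, Matrix.smul_apply,
      map_smul, smul_neg, RingHom.id_apply]

end Forms

end

/-! Everything rests on a positive trace: a linear form `T` on `A` with `T (x * y) = T (y * x)`, `T
(σ x) = T x` and `T (σ x * x) > 0` for `x ≠ 0`. It is the trace of the left regular representation,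
symmetrized by `σ`. Commuting symmetric elements of a Hermitian algebra generate a power of `ℝ`, so
`T (b ^ 2) ≥ 0` for symmetric `b`. If `a * σ a` is a square of a symmetric element for every unit
`a`, density of the units gives `T (σ x * x) ≥ 0` for all `x`, and semisimplicity makes this
definite (`isPositiveTrace_symTrace`). The condition on units is the congruence hypothesis at `x =
1`; when `Aˣ` is connected, it follows because it cuts out a clopen set containing `1`.

The positive trace passes to `Mat₂(A)` with `τ X = σ(X)ᵗ`. Hence `τ` is Hermitian, and each
invertible `g` is uniquely `k * exp X` with `k` unitary, `X` symmetric and `exp (2 X) = τ g * g`;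
smoothness comes from invertibility of the derivative of `exp` at symmetric elements. Since `Ω` is
unitary with `τ Ω = ± Ω`, this decomposition stays inside `Aut(ω)`, which gives real reductivity
(`IsSignedUnitary.isRealReductive`) with invariant form `T (X * Y)`.

Elements `exp X` with `X` in the Lie algebra act by inner automorphisms, so only `K` matters, and
`K` is the group of unitary elements commuting with `Ω`. For the symplectic form `Ω` is an imaginary
unit, and each such element is a single exponential `exp (Ω * x)`
(`IsHermitianInvolution.exists_exp_imaginary`). For the hyperbolic form `Ω` is a reflection and `K`
is a product of two copies of the unitary group of `A`. The latter is a continuous image of `Aˣ`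
under the polar decomposition, hence connected and generated by exponentials. -/

noncomputable section

/-! ### Spectral theorem for commuting symmetric elements -/

/-- A commutative finite-dimensional real algebra in which sums of two squares vanish only
trivially is a power of `ℝ`. -/
theorem exists_algEquiv_pi_real (S : Type*) [CommRing S] [Algebra ℝ S] [FiniteDimensional ℝ S]
    (h : ∀ x y : S, x ^ 2 + y ^ 2 = 0 → x = 0 ∧ y = 0) :
    Nonempty (S ≃ₐ[ℝ] (MaximalSpectrum S → ℝ)) := by
  classical
  have : IsArtinianRing S := IsArtinianRing.of_finite ℝ S
  have : IsReduced S := by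
    refine (isReduced_iff_pow_one_lt 2 one_lt_two).2 fun x hx => ?_
    exact (h x 0 (by rw [hx]; simp)).1
  let e : S ≃ₐ[ℝ] (∀ I : MaximalSpectrum S, S ⧸ I.asIdeal) :=
    (IsArtinianRing.equivPi S).restrictScalars ℝ
  have key : ∀ I : MaximalSpectrum S, Nonempty ((S ⧸ I.asIdeal) ≃ₐ[ℝ] ℝ) := by
    intro I
    let _ : Field (S ⧸ I.asIdeal) := Ideal.Quotient.field I.asIdeal
    rcases Real.nonempty_algEquiv_or (S ⧸ I.asIdeal) with h1 | ⟨⟨g⟩⟩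
    · exact h1
    -- A complex factor would contain `i` and `1`, with `i² + 1² = 0`.
    · exfalso
      have h2 := h (e.symm (Pi.single I (g.symm Complex.I))) (e.symm (Pi.single I 1)) (by
        rw [← map_pow, ← map_pow, ← map_add, sq, sq, ← Pi.single_mul, ← Pi.single_mul,
          ← Pi.single_add, ← map_mul, Complex.I_mul_I]
        simp)
      have h3 := h2.2
      rw [EmbeddingLike.map_eq_zero_iff, Pi.single_eq_zero_iff] at h3
      exact one_ne_zero h3
  exact ⟨e.trans (AlgEquiv.piCongrRight fun I => (key I).some)⟩

section Symmetric

variable {R : Type*} [Ring R] [Algebra ℝ R] {τ : R →ₗ[ℝ] R}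

theorem IsAntiInvolution.map_one (hτ : IsAntiInvolution τ) : τ 1 = 1 := by
  have h := hτ.map_mul (τ 1) 1
  rwa [mul_one, hτ.involutive, mul_one, eq_comm] at h

theorem IsAntiInvolution.map_algebraMap (hτ : IsAntiInvolution τ) (r : ℝ) :
    τ (algebraMap ℝ R r) = algebraMap ℝ R r := by
  rw [Algebra.algebraMap_eq_smul_one, map_smul, hτ.map_one]

theorem commute_of_mem_adjoin {s : Set R} (hs : ∀ a ∈ s, ∀ b ∈ s, a * b = b * a) {x y : R}
    (hx : x ∈ Algebra.adjoin ℝ s) (hy : y ∈ Algebra.adjoin ℝ s) : x * y = y * x :=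
  Algebra.commute_of_mem_adjoin_of_forall_mem_commute hy fun a ha =>
    (Algebra.commute_of_mem_adjoin_of_forall_mem_commute hx fun b hb => hs a ha b hb).symm

theorem IsAntiInvolution.map_eq_of_mem_adjoin (hτ : IsAntiInvolution τ) {s : Set R}
    (hs : ∀ a ∈ s, ∀ b ∈ s, a * b = b * a) (hsym : ∀ a ∈ s, τ a = a) {x : R}
    (hx : x ∈ Algebra.adjoin ℝ s) : τ x = x := by
  induction hx using Algebra.adjoin_induction with
  | mem x hx => exact hsym x hx
  | algebraMap r => exact hτ.map_algebraMap r
  | add x y _ _ hx hy => rw [map_add, hx, hy]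
  | mul x y hx' hy' hx hy => rw [hτ.map_mul, hx, hy, commute_of_mem_adjoin hs hx' hy']

open scoped IsMulCommutative in
/-- Simultaneous diagonalization of commuting symmetric elements. -/
theorem IsHermitianInvolution.exists_pi_algHom [FiniteDimensional ℝ R]
    (hH : IsHermitianInvolution τ) (hτ : IsAntiInvolution τ)
    {s : Set R} (hs : ∀ a ∈ s, ∀ b ∈ s, a * b = b * a) (hsym : ∀ a ∈ s, τ a = a) :
    ∃ (n : ℕ) (φ : (Fin n → ℝ) →ₐ[ℝ] R), Function.Injective φ ∧
      φ.range = Algebra.adjoin ℝ s := by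
  have := Algebra.isMulCommutative_adjoin ℝ hs
  have h : ∀ x y : Algebra.adjoin ℝ s, x ^ 2 + y ^ 2 = 0 → x = 0 ∧ y = 0 := by
    intro x y hxy
    have := hH x y (hτ.map_eq_of_mem_adjoin hs hsym x.2) (hτ.map_eq_of_mem_adjoin hs hsym y.2)
      (congrArg Subtype.val hxy)
    exact ⟨Subtype.ext this.1, Subtype.ext this.2⟩
  obtain ⟨e⟩ := exists_algEquiv_pi_real (Algebra.adjoin ℝ s) h
  have : IsArtinianRing (Algebra.adjoin ℝ s) := IsArtinianRing.of_finite ℝ _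
  let _ : Fintype (MaximalSpectrum (Algebra.adjoin ℝ s)) := Fintype.ofFinite _
  let f := e.trans (AlgEquiv.piCongrLeft ℝ (fun _ => ℝ)
    (Fintype.equivFin (MaximalSpectrum (Algebra.adjoin ℝ s))))
  refine ⟨_, (Algebra.adjoin ℝ s).val.comp f.symm.toAlgHom, ?_, ?_⟩
  · exact Subtype.val_injective.comp f.symm.injective
  · ext x
    constructor
    · rintro ⟨y, rfl⟩
      exact (f.symm y).2
    · intro hx
      exact ⟨f ⟨x, hx⟩, congrArg Subtype.val (f.symm_apply_apply ⟨x, hx⟩)⟩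

/-- The functional calculus of a symmetric element: functions of the eigenvalues `d` are again
symmetric because all of `φ` lands in the algebra generated by `x`. -/
theorem IsHermitianInvolution.exists_diagonalization [FiniteDimensional ℝ R]
    (hH : IsHermitianInvolution τ) (hτ : IsAntiInvolution τ) {x : R} (hx : τ x = x) :
    ∃ (n : ℕ) (φ : (Fin n → ℝ) →ₐ[ℝ] R) (d : Fin n → ℝ), Function.Injective φ ∧ φ d = x ∧
      ∀ c, τ (φ c) = φ c := by
  have hs : ∀ a ∈ ({x} : Set R), ∀ b ∈ ({x} : Set R), a * b = b * a := by
    rintro a rfl b rfl; rfl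
  have hsym : ∀ a ∈ ({x} : Set R), τ a = a := by rintro a rfl; exact hx
  obtain ⟨n, φ, hφ, hr⟩ := hH.exists_pi_algHom hτ hs hsym
  have : x ∈ φ.range := hr ▸ Algebra.subset_adjoin (Set.mem_singleton x)
  obtain ⟨d, hd⟩ := this
  exact ⟨n, φ, d, hφ, hd, fun c => hτ.map_eq_of_mem_adjoin hs hsym (hr ▸ ⟨c, rfl⟩)⟩

end Symmetric

/-! ### Exponentials in finite-dimensional real algebras -/

section Exp

variable {R : Type*} [NormedRing R] [NormedAlgebra ℝ R] [FiniteDimensional ℝ R]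

theorem exp_add_of_commute_real {x y : R} (h : Commute x y) :
    NormedSpace.exp (x + y) = NormedSpace.exp x * NormedSpace.exp y := by
  let _ : NormedAlgebra ℚ R := NormedAlgebra.restrictScalars ℚ ℝ R
  have : CompleteSpace R := FiniteDimensional.complete ℝ R
  exact NormedSpace.exp_add_of_commute h

theorem exp_mul_exp_neg_real (x : R) : NormedSpace.exp x * NormedSpace.exp (-x) = 1 := by
  rw [← exp_add_of_commute_real (Commute.neg_right (Commute.refl x)), add_neg_cancel,
    NormedSpace.exp_zero]

theorem exp_neg_mul_exp_real (x : R) : NormedSpace.exp (-x) * NormedSpace.exp x = 1 := by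
  simpa using exp_mul_exp_neg_real (-x)

/-- The exponential as a unit. -/
def expUnit (x : R) : Rˣ :=
  ⟨NormedSpace.exp x, NormedSpace.exp (-x), exp_mul_exp_neg_real x, exp_neg_mul_exp_real x⟩

omit [FiniteDimensional ℝ R] in
theorem map_exp_algHom {S : Type*} [NormedRing S] [NormedAlgebra ℝ S] [FiniteDimensional ℝ S]
    (φ : S →ₐ[ℝ] R) (x : S) : φ (NormedSpace.exp x) = NormedSpace.exp (φ x) := by
  let _ : NormedAlgebra ℚ R := NormedAlgebra.restrictScalars ℚ ℝ R
  let _ : NormedAlgebra ℚ S := NormedAlgebra.restrictScalars ℚ ℝ S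
  have : CompleteSpace S := FiniteDimensional.complete ℝ S
  exact NormedSpace.map_exp φ φ.toLinearMap.continuous_of_finiteDimensional x

omit [FiniteDimensional ℝ R] in
theorem exp_diagonal {n : ℕ} (φ : (Fin n → ℝ) →ₐ[ℝ] R) (d : Fin n → ℝ) :
    NormedSpace.exp (φ d) = φ fun i => Real.exp (d i) := by
  rw [← map_exp_algHom, Pi.exp_def, Real.exp_eq_exp_ℝ]

theorem exp_antiInvolution {τ : R →ₗ[ℝ] R} (hτ : IsAntiInvolution τ) (x : R) :
    τ (NormedSpace.exp x) = NormedSpace.exp (τ x) := by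
  have : CompleteSpace R := FiniteDimensional.complete ℝ R
  let _ : NormedAlgebra ℚ R := NormedAlgebra.restrictScalars ℚ ℝ R
  have h1 := (NormedSpace.exp_series_hasSum_exp' (𝕂 := ℝ) x).mapL
    (LinearMap.toContinuousLinearMap τ)
  refine h1.unique ?_
  have hp : ∀ n : ℕ, τ (x ^ n) = τ x ^ n := by
    intro n
    induction n with
    | zero => simp [hτ.map_one]
    | succ n ih => rw [pow_succ, hτ.map_mul, ih, pow_succ']
  have h2 := NormedSpace.exp_series_hasSum_exp' (𝕂 := ℝ) (τ x)
  simp only [← hp, ← map_smul] at h2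
  exact h2

section Symmetric

variable {τ : R →ₗ[ℝ] R}

/-- A symmetric element is a polynomial in its exponential. -/
theorem IsHermitianInvolution.mem_adjoin_exp (hH : IsHermitianInvolution τ)
    (hτ : IsAntiInvolution τ) {x : R} (hx : τ x = x) :
    x ∈ Algebra.adjoin ℝ {NormedSpace.exp x} := by
  classical
  obtain ⟨n, φ, d, -, rfl, -⟩ := hH.exists_diagonalization hτ hx
  rw [exp_diagonal]
  set c : Fin n → ℝ := fun i => Real.exp (d i)
  -- Interpolation of `log` at the eigenvalues of `exp x`; taking the image as a finset merges
  -- repeated eigenvalues.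
  let p := Lagrange.interpolate (Finset.univ.image c) id Real.log
  have hp : Polynomial.aeval c p = d := by
    funext i
    have h1 : Polynomial.aeval c p i = p.eval (c i) := by
      have := Polynomial.aeval_algHom_apply (Pi.evalAlgHom ℝ (fun _ : Fin n => ℝ) i) c p
      rw [Polynomial.coe_aeval_eq_eval] at this
      exact this.symm
    rw [h1]
    have h2 := Lagrange.eval_interpolate_at_node (s := Finset.univ.image c) (v := id) Real.log
      (Set.injOn_id _) (Finset.mem_image_of_mem c (Finset.mem_univ i))
    exact h2.trans (Real.log_exp _)
  have h := Polynomial.aeval_mem_adjoin_singleton ℝ (p := p) (φ c)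
  rwa [Polynomial.aeval_algHom_apply, hp] at h

theorem IsHermitianInvolution.commute_of_commute_exp (hH : IsHermitianInvolution τ)
    (hτ : IsAntiInvolution τ) {x y : R} (hx : τ x = x) (h : Commute y (NormedSpace.exp x)) :
    Commute y x :=
  Algebra.commute_of_mem_adjoin_singleton_of_commute (hH.mem_adjoin_exp hτ hx) h

/-- Since `y` is a polynomial in `exp y = exp x`, it commutes with `x`. Then `exp (x - y) = 1`, and
every eigenvalue of `x - y` is a real number with exponential `1`. -/
theorem IsHermitianInvolution.exp_injOn (hH : IsHermitianInvolution τ)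
    (hτ : IsAntiInvolution τ) {x y : R} (hx : τ x = x) (hy : τ y = y)
    (h : NormedSpace.exp x = NormedSpace.exp y) : x = y := by
  have hc : Commute x y := hH.commute_of_commute_exp hτ hy
    (h ▸ (Commute.refl x).exp_right)
  have h1 : NormedSpace.exp (x - y) = 1 := by
    rw [sub_eq_add_neg, exp_add_of_commute_real hc.neg_right, h, exp_mul_exp_neg_real]
  obtain ⟨n, φ, d, hφ, hd, -⟩ := hH.exists_diagonalization hτ (x := x - y) (by rw [map_sub, hx, hy])
  rw [← hd, exp_diagonal, ← map_one φ] at h1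
  have h3 : d = 0 := by
    funext i
    have := congrFun (hφ h1) i
    simpa using this
  rw [h3, map_zero] at hd
  exact (sub_eq_zero.1 hd.symm)

end Symmetric

end Exp

/-! ### Polar decomposition in algebras with a positive trace -/

/-- `T` is a `τ`-invariant trace on `R` for which `(x, y) ↦ T (τ x * y)` is positive definite. -/
structure IsPositiveTrace {R : Type*} [Ring R] [Algebra ℝ R] (τ : R →ₗ[ℝ] R) (T : R →ₗ[ℝ] ℝ) :
    Prop where
  anti : IsAntiInvolution τ
  mul_comm : ∀ x y, T (x * y) = T (y * x)
  star : ∀ x, T (τ x) = T x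
  pos : ∀ x, x ≠ 0 → 0 < T (τ x * x)

theorem IsPositiveTrace.isHermitian {R : Type*} [Ring R] [Algebra ℝ R] {τ : R →ₗ[ℝ] R}
    {T : R →ₗ[ℝ] ℝ} (h : IsPositiveTrace τ T) : IsHermitianInvolution τ := by
  have nonneg : ∀ x, τ x = x → 0 ≤ T (x ^ 2) := by
    intro x hx
    by_cases h0 : x = 0
    · simp [h0]
    · have := (h.pos x h0).le
      rwa [hx, ← sq] at this
  have key : ∀ x, τ x = x → T (x ^ 2) = 0 → x = 0 := by
    intro x hx hT
    by_contra h0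
    have := h.pos x h0
    rw [hx, ← sq, hT] at this
    exact lt_irrefl _ this
  intro x y hx hy hxy
  have h1 : T (x ^ 2) + T (y ^ 2) = 0 := by rw [← map_add, hxy, map_zero]
  have h2 := nonneg x hx
  have h3 := nonneg y hy
  exact ⟨key x hx (by linarith), key y hy (by linarith)⟩

section Polar

variable {R : Type*} [NormedRing R] [NormedAlgebra ℝ R] [FiniteDimensional ℝ R]
  {τ : R →ₗ[ℝ] R} {T : R →ₗ[ℝ] ℝ}

/-- The eigenvalues of `τ g * g` are positive, so half their logarithms define `x`. For a spectral
idempotent `e` with eigenvalue `λ`, positivity follows from `T (τ (g e) * (g e)) = λ * T e`, where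
both traces are positive. -/
theorem IsPositiveTrace.exists_log (h : IsPositiveTrace τ T) (g : Rˣ) :
    ∃ x, τ x = x ∧ NormedSpace.exp ((2 : ℝ) • x) = τ g * g := by
  classical
  obtain ⟨n, φ, d, hφ, hd, hsym⟩ := h.isHermitian.exists_diagonalization h.anti
    (x := τ g * g) (by rw [h.anti.map_mul, h.anti.involutive])
  have hpos : ∀ i, 0 < d i := by
    intro i
    let e : R := φ (Pi.single i 1)
    have he0 : e ≠ 0 := by
      intro h0
      have h1 : (Pi.single i 1 : Fin n → ℝ) = 0 := hφ (by rw [map_zero]; exact h0)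
      simp at h1
    have he2 : e * e = e := by
      change φ _ * φ _ = φ _
      rw [← map_mul, ← Pi.single_mul, one_mul]
    have h1 := h.pos e he0
    rw [hsym, he2] at h1
    have h2 := h.pos ((g : R) * e) (fun h0 => he0 (by simpa using h0))
    have h3 : τ ((g : R) * e) * ((g : R) * e) = d i • e := by
      rw [h.anti.map_mul, hsym, mul_assoc, ← mul_assoc (τ (g : R)), ← hd]
      change φ _ * (φ _ * φ _) = _ • φ _
      rw [← map_mul, ← map_mul, ← map_smul]
      congr 1
      funext j
      by_cases hj : j = i
      · subst hj; simp
      · simp [hj]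
    rw [h3, map_smul, smul_eq_mul] at h2
    exact (pos_iff_pos_of_mul_pos h2).2 h1
  refine ⟨φ fun i => Real.log (d i) / 2, hsym _, ?_⟩
  rw [← map_smul, exp_diagonal, ← hd]
  congr 1
  funext i
  simp only [Pi.smul_apply, smul_eq_mul]
  rw [mul_div_cancel₀ _ two_ne_zero, Real.exp_log (hpos i)]

theorem contDiff_exp_real : ContDiff ℝ ∞ (NormedSpace.exp : R → R) := by
  have : CompleteSpace R := FiniteDimensional.complete ℝ R
  rw [contDiff_iff_contDiffAt]
  exact fun x => (NormedSpace.exp_analytic (𝕂 := ℝ) x).contDiffAt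

/-- The derivative of `exp` at `x` is injective if everything that commutes with `exp x` commutes
with `x`. -/
theorem fderiv_exp_injective {x : R}
    (hx : ∀ y : R, Commute y (NormedSpace.exp x) → Commute y x) :
    Function.Injective (fderiv ℝ (NormedSpace.exp : R → R) x) := by
  have : CompleteSpace R := FiniteDimensional.complete ℝ R
  have hD : HasFDerivAt (NormedSpace.exp : R → R) (fderiv ℝ NormedSpace.exp x) x :=
    ((contDiff_exp_real (R := R)).differentiable (by simp) x).hasFDerivAt
  rw [injective_iff_map_eq_zero]
  intro y hy
  -- Differentiating the identity `z * exp z = exp z * z` at `x` along a `y` in the kernel leaves `y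
  -- * exp x = exp x * y`.
  have h1 : HasFDerivAt (fun z : R => z * NormedSpace.exp z - NormedSpace.exp z * z) _ x :=
    ((hasFDerivAt_id x).mul' hD).sub (hD.mul' (hasFDerivAt_id x))
  have h2 : (fun z : R => z * NormedSpace.exp z - NormedSpace.exp z * z) = fun _ => 0 := by
    funext z
    exact sub_eq_zero.2 ((Commute.refl z).exp_right)
  rw [h2] at h1
  have h3 := congrArg (fun L => L y) (h1.unique (hasFDerivAt_const (0 : R) x))
  simp only [sub_apply, add_apply, smul_apply, hy, smul_zero, mul_zero, zero_add, id, zero_apply,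
    ContinuousLinearMap.id_apply, smul_eq_mul, MulOpposite.smul_eq_mul_unop, MulOpposite.unop_op,
    add_zero] at h3
  have hc : Commute y x := hx y (sub_eq_zero.1 h3)
  have h4 : HasDerivAt (fun t : ℝ => NormedSpace.exp (x + t • y)) 0 0 := by
    have h5 : HasDerivAt (fun t : ℝ => x + t • y) y 0 := by
      simpa using ((hasDerivAt_id (0 : ℝ)).smul_const y).const_add x
    have h6 : HasFDerivAt (NormedSpace.exp : R → R) (fderiv ℝ NormedSpace.exp x)
        (x + (0 : ℝ) • y) := by simpa using hD
    have := h6.comp_hasDerivAt (0 : ℝ) h5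
    rwa [hy] at this
  -- As `x` and `y` commute, `exp (x + t y)` factors and its derivative at `0` is `exp x * y`; by
  -- the choice of `y` it is also zero.
  have h5 : HasDerivAt (fun t : ℝ => NormedSpace.exp x * NormedSpace.exp (t • y))
      (NormedSpace.exp x * (y * NormedSpace.exp ((0 : ℝ) • y))) 0 :=
    (hasDerivAt_exp_smul_const' y (0 : ℝ)).const_mul _
  have h6 : (fun t : ℝ => NormedSpace.exp (x + t • y)) =
      fun t : ℝ => NormedSpace.exp x * NormedSpace.exp (t • y) := by
    funext t
    exact exp_add_of_commute_real (hc.symm.smul_right t)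
  rw [h6] at h4
  have h7 := h5.unique h4
  rw [zero_smul, NormedSpace.exp_zero, mul_one] at h7
  have h8 := congrArg (NormedSpace.exp (-x) * ·) h7
  simpa [← mul_assoc, exp_neg_mul_exp_real] using h8

/-- A smooth local inverse of `exp`. -/
theorem exists_smooth_local_log {x : R}
    (hx : ∀ y : R, Commute y (NormedSpace.exp x) → Commute y x) :
    ∃ ψ : R → R, ContDiffAt ℝ ∞ ψ (NormedSpace.exp x) ∧ ψ (NormedSpace.exp x) = x ∧
      (∀ᶠ y in nhds (NormedSpace.exp x), NormedSpace.exp (ψ y) = y) ∧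
      ∀ᶠ z in nhds x, ψ (NormedSpace.exp z) = z := by
  have : CompleteSpace R := FiniteDimensional.complete ℝ R
  let D : R ≃L[ℝ] R := (LinearEquiv.ofInjectiveEndo
    ((fderiv ℝ (NormedSpace.exp : R → R) x : R →L[ℝ] R) : R →ₗ[ℝ] R)
    (fderiv_exp_injective hx)).toContinuousLinearEquiv
  have hD : HasFDerivAt (NormedSpace.exp : R → R) (D : R →L[ℝ] R) x := by
    have h1 := ((contDiff_exp_real (R := R)).differentiable (by simp) x).hasFDerivAt
    have h2 : (D : R →L[ℝ] R) = fderiv ℝ NormedSpace.exp x := ContinuousLinearMap.ext fun _ => rfl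
    rw [h2]
    exact h1
  have hc : ContDiffAt ℝ ∞ (NormedSpace.exp : R → R) x := contDiff_exp_real.contDiffAt
  have hs := hc.hasStrictFDerivAt' hD (by simp)
  exact ⟨hc.localInverse hD (by simp), hc.to_localInverse hD (by simp),
    hc.localInverse_apply_image hD (by simp), hs.eventually_right_inverse,
    hs.eventually_left_inverse⟩

/-- Near the exponential of a symmetric element there is a smooth logarithm which takes symmetric
elements to symmetric elements. -/
theorem IsHermitianInvolution.exists_smooth_log (hH : IsHermitianInvolution τ)
    (hτ : IsAntiInvolution τ) {x : R} (hx : τ x = x) :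
    ∃ ψ : R → R, ContDiffAt ℝ ∞ ψ (NormedSpace.exp x) ∧
      ∀ᶠ y in nhds (NormedSpace.exp x), τ y = y → τ (ψ y) = ψ y ∧ NormedSpace.exp (ψ y) = y := by
  obtain ⟨ψ, hψ, hψx, hright, hleft⟩ := exists_smooth_local_log (x := x)
    fun y hy => hH.commute_of_commute_exp hτ hx hy
  -- For symmetric `y` near `exp x`, the element `τ (ψ y)` is close to `x` and has exponential `τ y
  -- = y`, so the local left inverse identifies it with `ψ y`.
  have hcont : Filter.Tendsto (fun y => τ (ψ y)) (nhds (NormedSpace.exp x)) (nhds x) := by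
    have h1 : ContinuousAt (fun y => τ (ψ y)) (NormedSpace.exp x) :=
      τ.continuous_of_finiteDimensional.continuousAt.comp hψ.continuousAt
    have h2 : τ (ψ (NormedSpace.exp x)) = x := by rw [hψx, hx]
    simpa only [ContinuousAt, h2] using h1
  refine ⟨ψ, hψ, ?_⟩
  filter_upwards [hright, hcont.eventually hleft] with y hy1 hy2 hy
  refine ⟨?_, hy1⟩
  rw [← exp_antiInvolution hτ, hy1, hy] at hy2
  exact hy2.symm

/-- The symmetric component of the polar decomposition: the symmetric `x` with
`exp (2 x) = τ g * g`. -/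
def polarLog (τ : R →ₗ[ℝ] R) (g : R) : R :=
  open Classical in
  if h : ∃ x, τ x = x ∧ NormedSpace.exp ((2 : ℝ) • x) = τ g * g then h.choose else 0

theorem IsPositiveTrace.polarLog_spec (h : IsPositiveTrace τ T) (g : Rˣ) :
    τ (polarLog τ (g : R)) = polarLog τ (g : R) ∧
      NormedSpace.exp ((2 : ℝ) • polarLog τ (g : R)) = τ g * g := by
  have h1 := h.exists_log g
  rw [polarLog, dif_pos h1]
  exact h1.choose_spec

theorem IsPositiveTrace.polarLog_eq (h : IsPositiveTrace τ T) {g : Rˣ} {x : R} (hx : τ x = x)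
    (hg : NormedSpace.exp ((2 : ℝ) • x) = τ g * g) : polarLog τ (g : R) = x := by
  obtain ⟨h1, h2⟩ := h.polarLog_spec g
  have h3 := h.isHermitian.exp_injOn h.anti (by rw [map_smul, h1]) (by rw [map_smul, hx])
    (h2.trans hg.symm)
  exact smul_right_injective R (two_ne_zero (α := ℝ)) h3

/-- Uniqueness of symmetric logarithms forces `polarLog τ y = ½ ψ (τ y * y)` for `y` near `g`, with
`ψ` a smooth local logarithm at `τ g * g`. Nearby elements are automatically units. -/
theorem IsPositiveTrace.contDiffAt_polarLog (h : IsPositiveTrace τ T) (g : Rˣ) :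
    ContDiffAt ℝ ∞ (polarLog τ) (g : R) := by
  have : CompleteSpace R := FiniteDimensional.complete ℝ R
  obtain ⟨h1, h2⟩ := h.polarLog_spec g
  obtain ⟨ψ, hψ, hev⟩ := h.isHermitian.exists_smooth_log h.anti
    (x := (2 : ℝ) • polarLog τ (g : R)) (by rw [map_smul, h1])
  rw [h2] at hψ hev
  have hτ : ContDiff ℝ ∞ τ := (LinearMap.toContinuousLinearMap τ).contDiff
  have hq : ContDiff ℝ ∞ fun y : R => τ y * y := hτ.mul contDiff_id
  have hs : ContDiffAt ℝ ∞ (fun y : R => (2 : ℝ)⁻¹ • ψ (τ y * y)) (g : R) :=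
    (ContDiffAt.comp (g := ψ) (f := fun y : R => τ y * y) (g : R) hψ
      hq.contDiffAt).const_smul _
  refine hs.congr_of_eventuallyEq ?_
  filter_upwards [hq.continuous.continuousAt.eventually hev, Units.nhds g] with y hy hu
  obtain ⟨u, rfl⟩ := hu
  obtain ⟨h3, h4⟩ := hy (by rw [h.anti.map_mul, h.anti.involutive])
  refine h.polarLog_eq (by rw [map_smul, h3]) ?_
  rw [smul_smul, mul_inv_cancel₀ two_ne_zero, one_smul, h4]

theorem IsPositiveTrace.polarLog_mul_exp (h : IsPositiveTrace τ T) {k : Rˣ}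
    (hk : τ k * k = 1) {x : R} (hx : τ x = x) :
    polarLog τ ((k : R) * NormedSpace.exp x) = x := by
  refine h.polarLog_eq (g := k * expUnit x) hx ?_
  have h1 : ((k * expUnit x : Rˣ) : R) = k * NormedSpace.exp x := rfl
  rw [h1, h.anti.map_mul, exp_antiInvolution h.anti, hx, mul_assoc, ← mul_assoc (τ (k : R)), hk,
    one_mul, ← exp_add_of_commute_real (Commute.refl x), two_smul]

theorem IsPositiveTrace.polar_unitary (h : IsPositiveTrace τ T) (g : Rˣ) :
    τ ((g : R) * NormedSpace.exp (-polarLog τ (g : R))) *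
      ((g : R) * NormedSpace.exp (-polarLog τ (g : R))) = 1 := by
  obtain ⟨h1, h2⟩ := h.polarLog_spec g
  rw [h.anti.map_mul, exp_antiInvolution h.anti, map_neg, h1, mul_assoc, ← mul_assoc (τ (g : R)),
    ← h2, two_smul, exp_add_of_commute_real (Commute.refl _), mul_assoc (NormedSpace.exp _),
    exp_mul_exp_neg_real, mul_one, exp_neg_mul_exp_real]

/-- A symmetric element all of whose integral multiples have bounded exponentials vanishes. -/
theorem IsHermitianInvolution.eq_zero_of_bounded_exp (hH : IsHermitianInvolution τ)
    (hτ : IsAntiInvolution τ) {x : R} (hx : τ x = x) {C : ℝ}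
    (hC : ∀ n : ℤ, ‖NormedSpace.exp ((n : ℝ) • x)‖ ≤ C) : x = 0 := by
  classical
  obtain ⟨n, φ, d, hφ, rfl, -⟩ := hH.exists_diagonalization hτ hx
  have key : ∀ (i : Fin n) (m : ℤ), Real.exp (m * d i) ≤ C := by
    intro i m
    let e : R := φ (Pi.single i 1)
    have he0 : 0 < ‖e‖ := by
      rw [norm_pos_iff]
      intro h0
      have h1 : (Pi.single i 1 : Fin n → ℝ) = 0 := hφ (by rw [map_zero]; exact h0)
      simp at h1
    have h1 : NormedSpace.exp ((m : ℝ) • φ d) * e = Real.exp (m * d i) • e := by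
      rw [← map_smul, exp_diagonal]
      change φ _ * φ _ = _ • φ _
      rw [← map_mul, ← map_smul]
      congr 1
      funext j
      by_cases hj : j = i
      · subst hj; simp
      · simp [hj]
    have h2 := norm_mul_le (NormedSpace.exp ((m : ℝ) • φ d)) e
    rw [h1, norm_smul, Real.norm_of_nonneg (Real.exp_pos _).le] at h2
    exact (le_of_mul_le_mul_right h2 he0).trans (hC m)
  have hd : d = 0 := by
    funext i
    by_contra h0
    -- With `m |d i| > C`, the inequality `1 + t ≤ exp t` at `t = m |d i|` beats the bound; a
    -- negative eigenvalue needs the multiple `-m`.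
    obtain ⟨m, hm⟩ := exists_nat_gt (C / |d i|)
    rw [div_lt_iff₀ (abs_pos.2 h0)] at hm
    rcases abs_cases (d i) with ⟨h1, -⟩ | ⟨h1, -⟩
    · have := key i m
      have h2 := Real.add_one_le_exp ((m : ℤ) * d i : ℝ)
      push_cast at this h2
      rw [h1] at hm
      linarith
    · have := key i (-m)
      have h2 := Real.add_one_le_exp (((-m : ℤ) : ℝ) * d i : ℝ)
      push_cast at this h2
      rw [h1] at hm
      linarith
  rw [hd, map_zero]

end Polar

/-! ### The positive trace of a Hermitian algebra -/

section TraceForm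

theorem trace_nonneg_of_isIdempotentElem {V : Type*} [AddCommGroup V] [Module ℝ V]
    [FiniteDimensional ℝ V] {f : V →ₗ[ℝ] V} (hf : IsIdempotentElem f) :
    0 ≤ LinearMap.trace ℝ V f := by
  rw [(LinearMap.IsIdempotentElem.isProj_range f hf).trace]
  positivity

variable {A : Type*} [Ring A] [Algebra ℝ A]

/-- The symmetrized trace `x ↦ tr (L_x) + tr (L_(σ x))` of the left regular representation. -/
def symTrace (σ : A →ₗ[ℝ] A) : A →ₗ[ℝ] ℝ :=
  LinearMap.trace ℝ A ∘ₗ LinearMap.mul ℝ A + LinearMap.trace ℝ A ∘ₗ LinearMap.mul ℝ A ∘ₗ σ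

theorem symTrace_apply (σ : A →ₗ[ℝ] A) (x : A) :
    symTrace σ x = LinearMap.trace ℝ A (Algebra.lmul ℝ A x) +
      LinearMap.trace ℝ A (Algebra.lmul ℝ A (σ x)) := rfl

variable {σ : A →ₗ[ℝ] A}

theorem symTrace_mul_comm (hσ : IsAntiInvolution σ) (x y : A) :
    symTrace σ (x * y) = symTrace σ (y * x) := by
  simp only [symTrace_apply, hσ.map_mul, map_mul]
  rw [LinearMap.trace_mul_comm ℝ (Algebra.lmul ℝ A x),
    LinearMap.trace_mul_comm ℝ (Algebra.lmul ℝ A (σ x))]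

theorem symTrace_star (hσ : IsAntiInvolution σ) (x : A) : symTrace σ (σ x) = symTrace σ x := by
  rw [symTrace_apply, symTrace_apply, hσ.involutive, add_comm]

variable [FiniteDimensional ℝ A]

theorem symTrace_idempotent_nonneg (hσ : IsAntiInvolution σ) {e : A} (he : IsIdempotentElem e) :
    0 ≤ symTrace σ e := by
  rw [symTrace_apply]
  refine add_nonneg (trace_nonneg_of_isIdempotentElem (he.map (Algebra.lmul ℝ A)))
    (trace_nonneg_of_isIdempotentElem (IsIdempotentElem.map (e := σ e) ?_ (Algebra.lmul ℝ A)))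
  rw [IsIdempotentElem, ← hσ.map_mul, he.eq]

/-- Both summands are ranks of idempotents, so left multiplication by `e` has rank zero; evaluate it
at `1`. -/
theorem symTrace_idempotent_eq_zero (hσ : IsAntiInvolution σ) {e : A} (he : IsIdempotentElem e)
    (h : symTrace σ e = 0) : e = 0 := by
  have he' : IsIdempotentElem (σ e) := by rw [IsIdempotentElem, ← hσ.map_mul, he.eq]
  rw [symTrace_apply] at h
  have h1 := trace_nonneg_of_isIdempotentElem (he.map (Algebra.lmul ℝ A))
  have h2 := trace_nonneg_of_isIdempotentElem (he'.map (Algebra.lmul ℝ A))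
  have h3 := LinearMap.IsIdempotentElem.eq_zero_of_trace_eq_zero (he.map (Algebra.lmul ℝ A))
    (by linarith)
  have h4 := LinearMap.congr_fun h3 1
  simpa using h4

/-- By the spectral decomposition, `b ^ 2` is a combination of idempotents with coefficients `d i ^
2`. -/
theorem symTrace_sq_nonneg (hσ : IsAntiInvolution σ) (hH : IsHermitianInvolution σ) {b : A}
    (hb : σ b = b) : 0 ≤ symTrace σ (b ^ 2) := by
  classical
  obtain ⟨n, φ, d, -, rfl, -⟩ := hH.exists_diagonalization hσ hb
  have h1 : φ d ^ 2 = ∑ i, d i ^ 2 • φ (Pi.single i 1) := by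
    rw [← map_pow]
    simp only [← map_smul, ← map_sum]
    congr 1
    funext j
    simp [Finset.sum_apply, Pi.single_apply]
  rw [h1, map_sum]
  refine Finset.sum_nonneg fun i _ => ?_
  rw [map_smul, smul_eq_mul]
  refine mul_nonneg (sq_nonneg _) (symTrace_idempotent_nonneg hσ ?_)
  rw [IsIdempotentElem, ← map_mul, ← Pi.single_mul, one_mul]

end TraceForm

section Hermitian

variable {A : Type*} [NormedRing A] [NormedAlgebra ℝ A] [FiniteDimensional ℝ A] {σ : A →ₗ[ℝ] A}

/-- For a unit `u`, the element `u * σ u` is a square of a symmetric element. Since `x + t` is a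
unit for all small `t ≠ 0`, by finiteness of the spectrum, the inequality passes to `x` in the
limit. -/
theorem symTrace_star_mul_self_nonneg (hσ : IsAntiInvolution σ) (hH : IsHermitianInvolution σ)
    (hu : ∀ a : Aˣ, (a : A) * σ a ∈ nonnegElements σ) (x : A) : 0 ≤ symTrace σ (σ x * x) := by
  have : CompleteSpace A := FiniteDimensional.complete ℝ A
  rw [symTrace_mul_comm hσ]
  have hc : Continuous fun t : ℝ =>
      symTrace σ ((x + algebraMap ℝ A t) * σ (x + algebraMap ℝ A t)) := by
    have h1 : Continuous (symTrace σ) := LinearMap.continuous_of_finiteDimensional _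
    have h2 : Continuous σ := LinearMap.continuous_of_finiteDimensional _
    have h3 : Continuous fun t : ℝ => x + algebraMap ℝ A t :=
      continuous_const.add (continuous_algebraMap ℝ A)
    exact h1.comp (h3.mul (h2.comp h3))
  have hlim := (hc.tendsto 0).mono_left (nhdsWithin_le_nhds (s := {0}ᶜ))
  have hz : x + algebraMap ℝ A 0 = x := by rw [map_zero, add_zero]
  rw [hz] at hlim
  refine ge_of_tendsto hlim ?_
  have hfin : (spectrum ℝ (-x)).Finite := by
    have := Module.End.finite_spectrum (Algebra.lmul ℝ A (-x))
    refine this.subset fun r hr hr' => hr ?_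
    rw [spectrum.mem_resolventSet_iff] at hr' ⊢
    rwa [← (Algebra.lmul ℝ A).commutes, ← map_sub, Algebra.lmul_isUnit_iff] at hr'
  have hev : ∀ᶠ t : ℝ in nhdsWithin 0 {0}ᶜ, t ∉ spectrum ℝ (-x) := by
    have h1 : ∀ᶠ t : ℝ in nhdsWithin 0 {0}ᶜ, t ∉ spectrum ℝ (-x) \ {0} := by
      refine Filter.Eventually.filter_mono nhdsWithin_le_nhds ?_
      exact (hfin.subset Set.sdiff_subset).isClosed.isOpen_compl.mem_nhds (by simp)
    filter_upwards [h1, self_mem_nhdsWithin] with t h2 h3 h4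
    exact h2 ⟨h4, h3⟩
  filter_upwards [hev] with t ht
  rw [spectrum.notMem_iff] at ht
  obtain ⟨u, hu'⟩ := ht
  obtain ⟨b, hb, hb2⟩ := hu u
  rw [show x + algebraMap ℝ A t = u by rw [hu']; abel, hb2]
  exact symTrace_sq_nonneg hσ hH hb

/-- A semidefinite form fails to be definite only through its radical, which here is a left ideal up
to `σ`. Semisimplicity makes that ideal generated by an idempotent; its trace vanishes, so it is
zero. -/
theorem isPositiveTrace_symTrace [IsSemisimpleRing A] (hσ : IsAntiInvolution σ)
    (hH : IsHermitianInvolution σ) (hu : ∀ a : Aˣ, (a : A) * σ a ∈ nonnegElements σ) :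
    IsPositiveTrace σ (symTrace σ) where
  anti := hσ
  mul_comm := symTrace_mul_comm hσ
  star := symTrace_star hσ
  pos := by
    have hnn := symTrace_star_mul_self_nonneg hσ hH hu
    intro x hx
    refine lt_of_le_of_ne (hnn x) fun h0 => hx ?_
    have horth : ∀ y, symTrace σ (σ x * y) = 0 := by
      intro y
      set c := symTrace σ (σ x * y) with hc
      set q := symTrace σ (σ y * y) with hq
      have hq0 : 0 ≤ q := hnn y
      have hc' : symTrace σ (σ y * x) = c := by
        rw [← symTrace_star hσ, hσ.map_mul, hσ.involutive]
      have h1 : ∀ t : ℝ, 0 ≤ 2 * t * c + t ^ 2 * q := by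
        intro t
        have h2 := hnn (x + t • y)
        simp only [map_add, map_smul, add_mul, mul_add, smul_mul_assoc, mul_smul_comm,
          smul_eq_mul, ← h0, hc', ← hc, ← hq] at h2
        linarith
      -- The minimizer would be `-c / q`; the shifted denominator avoids the case `q = 0` and still
      -- yields a negative value unless `c = 0`.
      have h2 := h1 (-c / (q + 1))
      have h3 : 2 * (-c / (q + 1)) * c + (-c / (q + 1)) ^ 2 * q =
          -(c ^ 2 * (q + 2)) / (q + 1) ^ 2 := by
        field_simp
        ring
      rw [h3] at h2
      by_contra hne
      have h4 : 0 < c ^ 2 * (q + 2) / (q + 1) ^ 2 := by positivity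
      rw [neg_div] at h2
      linarith
    let I : Ideal A :=
      { carrier := {z | ∀ y, symTrace σ (y * z) = 0}
        add_mem' := fun {a b} ha hb y => by rw [mul_add, map_add, ha, hb, add_zero]
        zero_mem' := fun y => by rw [mul_zero, map_zero]
        smul_mem' := fun c z hz y => by rw [smul_eq_mul, ← mul_assoc]; exact hz _ }
    obtain ⟨e, he, hI⟩ := IsSemisimpleRing.ideal_eq_span_idempotent I
    have he0 : e = 0 := by
      refine symTrace_idempotent_eq_zero hσ he ?_
      have h1 : e ∈ I := hI ▸ Ideal.mem_span_singleton_self e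
      have h2 := h1 1
      rwa [one_mul] at h2
    have hxI : σ x ∈ I := fun y => by rw [symTrace_mul_comm hσ]; exact horth y
    rw [hI, he0, Ideal.span_singleton_eq_bot.2 rfl, Ideal.mem_bot] at hxI
    rw [← hσ.involutive x, hxI, map_zero]

/-- Squaring has no zero on the compact unit sphere of symmetric elements, so `ε ‖b‖² ≤ ‖b²‖` for
symmetric `b`. Hence symmetric square roots of a convergent sequence are bounded, and a subsequence
of them converges. -/
theorem isClosed_nonnegElements (hH : IsHermitianInvolution σ) :
    IsClosed (nonnegElements σ) := by
  have : ProperSpace A := FiniteDimensional.proper ℝ A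
  have hσc : Continuous σ := σ.continuous_of_finiteDimensional
  have hS : IsCompact {x : A | σ x = x ∧ ‖x‖ = 1} := by
    refine (isCompact_sphere (0 : A) 1).of_isClosed_subset ?_ fun x hx => by simpa using hx.2
    exact (isClosed_eq hσc continuous_id).inter (isClosed_eq continuous_norm continuous_const)
  have h0 : (0 : A) ∉ (fun x : A => x ^ 2) '' {x : A | σ x = x ∧ ‖x‖ = 1} := by
    rintro ⟨x, ⟨hx, hx1⟩, hx2⟩
    have := (hH x 0 hx (map_zero σ) (by simpa using hx2)).1
    simp [this] at hx1
  obtain ⟨ε, hε, hball⟩ := Metric.isOpen_iff.1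
    (hS.image (continuous_pow 2)).isClosed.isOpen_compl 0 h0
  have hbound : ∀ b : A, σ b = b → ε * ‖b‖ ^ 2 ≤ ‖b ^ 2‖ := by
    intro b hb
    by_cases hb0 : b = 0
    · simp [hb0]
    have hn : 0 < ‖b‖ := norm_pos_iff.2 hb0
    by_contra! hlt
    refine hball (a := (‖b‖⁻¹ • b) ^ 2) ?_ ⟨‖b‖⁻¹ • b, ⟨by rw [map_smul, hb], ?_⟩, rfl⟩
    · rw [mem_ball_zero_iff, smul_pow, norm_smul, norm_pow, norm_inv, norm_norm, inv_pow,
        inv_mul_lt_iff₀ (by positivity), mul_comm]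
      exact hlt
    · rw [norm_smul, norm_inv, norm_norm, inv_mul_cancel₀ hn.ne']
  refine IsSeqClosed.isClosed fun u s hu hlim => ?_
  choose b hb hb2 using hu
  obtain ⟨M, hM⟩ := hlim.norm.bddAbove_range
  have hbd : ∀ n, b n ∈ Metric.closedBall (0 : A) (Real.sqrt (M / ε)) := by
    intro n
    rw [mem_closedBall_zero_iff]
    refine Real.le_sqrt_of_sq_le ?_
    rw [le_div_iff₀ hε, mul_comm]
    exact (hbound _ (hb n)).trans (hb2 n ▸ hM ⟨n, rfl⟩)
  obtain ⟨b0, -, ψ, hψ, hlimb⟩ := (isCompact_closedBall (0 : A) _).tendsto_subseq hbd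
  refine ⟨b0, ?_, ?_⟩
  · refine tendsto_nhds_unique ((hσc.tendsto b0).comp hlimb) ?_
    refine hlimb.congr fun n => ?_
    simp [hb]
  · refine tendsto_nhds_unique (hlim.comp hψ.tendsto_atTop) ?_
    refine ((continuous_pow 2).tendsto b0 |>.comp hlimb).congr fun n => ?_
    simp [hb2]

/-- An invertible square of a symmetric element has positive eigenvalues, so it is the exponential
of a symmetric element. The smooth logarithm `ψ` there preserves symmetry, and `exp (½ ψ y)` is a
symmetric square root of `y`. -/
theorem eventually_mem_nonnegElements (hσ : IsAntiInvolution σ) (hH : IsHermitianInvolution σ)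
    {s : A} (hs : s ∈ nonnegElements σ) (hsu : IsUnit s) :
    ∀ᶠ y in nhds s, σ y = y → y ∈ nonnegElements σ := by
  classical
  obtain ⟨b, hb, rfl⟩ := hs
  obtain ⟨n, φ, d, hφ, rfl, hsym⟩ := hH.exists_diagonalization hσ hb
  have hd : ∀ i, 0 < d i ^ 2 := by
    intro i
    refine lt_of_le_of_ne (sq_nonneg _) fun h0 => ?_
    have h1 : φ d ^ 2 * φ (Pi.single i 1) = 0 := by
      rw [← map_pow, ← map_mul, ← map_zero φ]
      congr 1
      funext j
      by_cases hj : j = i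
      · subst hj; simp [← h0]
      · simp [hj]
    rw [hsu.mul_right_eq_zero, ← map_zero φ] at h1
    have h2 := hφ h1
    simp at h2
  have hexp : NormedSpace.exp (φ fun i => Real.log (d i ^ 2)) = φ d ^ 2 := by
    rw [exp_diagonal, ← map_pow]
    congr 1
    funext i
    exact Real.exp_log (hd i)
  obtain ⟨ψ, -, hψ⟩ := hH.exists_smooth_log hσ (hsym fun i => Real.log (d i ^ 2))
  rw [hexp] at hψ
  filter_upwards [hψ] with y hy hy'
  obtain ⟨h1, h2⟩ := hy hy'
  refine ⟨NormedSpace.exp ((2 : ℝ)⁻¹ • ψ y), by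
    rw [exp_antiInvolution hσ, map_smul, h1], ?_⟩
  rw [sq, ← exp_add_of_commute_real (Commute.refl _), ← two_smul ℝ, smul_smul,
    mul_inv_cancel₀ two_ne_zero, one_smul, h2]

/-- The condition on `a` is closed and, at units, also open; it holds at `a = 1`. -/
theorem mul_star_mem_nonnegElements_of_connectedSpace (hσ : IsAntiInvolution σ)
    (hH : IsHermitianInvolution σ) [ConnectedSpace Aˣ] (a : Aˣ) :
    (a : A) * σ a ∈ nonnegElements σ := by
  have hc : Continuous fun a : Aˣ => (a : A) * σ a :=
    Units.continuous_val.mul (σ.continuous_of_finiteDimensional.comp Units.continuous_val)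
  have hcl : IsClopen {a : Aˣ | (a : A) * σ a ∈ nonnegElements σ} := by
    refine ⟨(isClosed_nonnegElements hH).preimage hc, isOpen_iff_mem_nhds.2 fun a ha => ?_⟩
    have hu : IsUnit ((a : A) * σ a) := a.isUnit.mul
      ⟨⟨σ a, σ ↑a⁻¹, by rw [← hσ.map_mul, Units.inv_mul, hσ.map_one],
        by rw [← hσ.map_mul, Units.mul_inv, hσ.map_one]⟩, rfl⟩
    filter_upwards [hc.continuousAt.eventually (eventually_mem_nonnegElements hσ hH ha hu)]
      with x hx
    exact hx (by rw [hσ.map_mul, hσ.involutive])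
  have h1 := hcl.eq_univ ⟨1, 1, hσ.map_one, by simp [hσ.map_one]⟩
  exact (Set.ext_iff.1 h1 a).2 trivial

end Hermitian

/-! ### Two by two matrices -/

section Matrix

variable {A : Type*} [Ring A] [Algebra ℝ A]

/-- The involution `X ↦ σ(X)ᵗ` of `Mat₂(A)`. -/
def matInvolution (σ : A →ₗ[ℝ] A) : Matrix (Fin 2) (Fin 2) A →ₗ[ℝ] Matrix (Fin 2) (Fin 2) A where
  toFun X := (X.map σ)ᵀ
  map_add' X Y := by ext i j; simp
  map_smul' c X := by ext i j; simp

theorem matInvolution_apply (σ : A →ₗ[ℝ] A) (X : Matrix (Fin 2) (Fin 2) A) (i j : Fin 2) :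
    matInvolution σ X i j = σ (X j i) := rfl

/-- The trace form on `Mat₂(A)` induced by a linear form on `A`. -/
def matTrace (T : A →ₗ[ℝ] ℝ) : Matrix (Fin 2) (Fin 2) A →ₗ[ℝ] ℝ :=
  T ∘ₗ Matrix.traceLinearMap (Fin 2) ℝ A

theorem matTrace_apply (T : A →ₗ[ℝ] ℝ) (X : Matrix (Fin 2) (Fin 2) A) :
    matTrace T X = T (X 0 0) + T (X 1 1) := by
  simp [matTrace, Matrix.trace_fin_two]

/-- Positivity reduces to entries: `τ X * X` has trace `∑ T (σ (X i j) * X i j)`. -/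
theorem IsPositiveTrace.matTrace {σ : A →ₗ[ℝ] A} {T : A →ₗ[ℝ] ℝ} (h : IsPositiveTrace σ T) :
    IsPositiveTrace (matInvolution σ) (matTrace T) where
  anti :=
    { map_mul := fun X Y => by
        ext i j
        simp only [matInvolution_apply, Matrix.mul_apply, map_sum, h.anti.map_mul]
      involutive := fun X => by
        ext i j
        simp only [matInvolution_apply, h.anti.involutive] }
  mul_comm X Y := by
    simp only [matTrace_apply, Matrix.mul_apply, Fin.sum_univ_two, map_add]
    rw [h.mul_comm (X 0 0), h.mul_comm (X 0 1), h.mul_comm (X 1 0), h.mul_comm (X 1 1)]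
    ring
  star X := by simp only [matTrace_apply, matInvolution_apply, h.star]
  pos X hX := by
    have hnn : ∀ x, 0 ≤ T (σ x * x) := by
      intro x
      by_cases hx : x = 0
      · simp [hx]
      · exact (h.pos x hx).le
    have hsum : _root_.matTrace T (matInvolution σ X * X) =
        ∑ i, ∑ j, T (σ (X i j) * X i j) := by
      simp only [matTrace_apply, Matrix.mul_apply, Fin.sum_univ_two, map_add, matInvolution_apply]
      ring
    rw [hsum]
    have : ∃ i j, X i j ≠ 0 := by
      by_contra! h0
      exact hX (by ext i j; exact h0 i j)
    obtain ⟨i, j, hij⟩ := this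
    refine Finset.sum_pos' (fun i _ => Finset.sum_nonneg fun j _ => hnn _)
      ⟨i, Finset.mem_univ i, Finset.sum_pos' (fun j _ => hnn _) ⟨j, Finset.mem_univ j, h.pos _ hij⟩⟩

end Matrix

/-! ### Reductivity -/

section Reductive

variable {L : Type*} [LieRing L] [LieAlgebra ℝ L] [FiniteDimensional ℝ L]

/-- With an inner product for which every `ad x` has an adjoint of the form `ad (s x)`, abelian
ideals are central. -/
theorem lie_eq_zero_of_abelian_ideal (β : LinearMap.BilinForm ℝ L)
    (hpos : ∀ x, x ≠ 0 → 0 < β x x) (hsymm : ∀ x y, β x y = β y x) (s : L → L)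
    (hadj : ∀ x y z, β ⁅x, y⁆ z = β y ⁅s x, z⁆) (I : LieIdeal ℝ L)
    (hI : ∀ x ∈ I, ∀ y ∈ I, ⁅x, y⁆ = 0) {x : L} (hx : x ∈ I) (y : L) : ⁅y, x⁆ = 0 := by
  have hrefl : β.IsRefl := fun a b hab => by rw [hsymm]; exact hab
  have hzero : ∀ z, β z z = 0 → z = 0 := fun z hz => by
    by_contra h
    exact (hpos z h).ne' hz
  have hcompl : IsCompl (I : Submodule ℝ L) (β.orthogonal I) := by
    rw [LinearMap.BilinForm.isCompl_orthogonal_iff_disjoint hrefl, Submodule.disjoint_def]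
    exact fun z hz hz' => hzero z (hz' z hz)
  have hy : y ∈ (I : Submodule ℝ L) ⊔ β.orthogonal I := hcompl.sup_eq_top ▸ Submodule.mem_top
  obtain ⟨i, hi, j, hj, rfl⟩ := Submodule.mem_sup.1 hy
  rw [add_lie, hI i hi x hx, zero_add]
  refine hzero _ ?_
  -- This element of the ideal is orthogonal to `j`; moving `s x` across the form turns that pairing
  -- into minus the squared norm of `⁅j, x⁆`.
  have h1 : ⁅s x, ⁅j, x⁆⁆ ∈ I := lie_mem_right ℝ L I _ _ (lie_mem_right ℝ L I _ _ hx)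
  have h2 : β ⁅s x, ⁅j, x⁆⁆ j = 0 := hj _ h1
  have h3 : β ⁅x, j⁆ ⁅j, x⁆ = 0 := by rw [hadj, hsymm, h2]
  have h4 : β ⁅j, x⁆ ⁅j, x⁆ = β (-⁅x, j⁆) ⁅j, x⁆ :=
    congrArg (fun w => β w ⁅j, x⁆) (lie_skew j x).symm
  rw [h4, map_neg, LinearMap.neg_apply, h3, neg_zero]

/-- A real Lie algebra with an inner product for which every `ad x` has an adjoint of the form
`ad (s x)` is reductive. -/
theorem hasCentralRadical_of_adjoint (β : LinearMap.BilinForm ℝ L)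
    (hpos : ∀ x, x ≠ 0 → 0 < β x x) (hsymm : ∀ x y, β x y = β y x) (s : L → L)
    (hadj : ∀ x y z, β ⁅x, y⁆ z = β y ⁅s x, z⁆) : LieAlgebra.HasCentralRadical ℝ L := by
  have hcen := lie_eq_zero_of_abelian_ideal β hpos hsymm s hadj
  set I := LieAlgebra.radical ℝ L
  let D := fun k => LieAlgebra.derivedSeriesOfIdeal ℝ L k I
  have hab : ∀ k, D (k + 1) = ⊥ → ∀ x ∈ D k, ∀ y ∈ D k, ⁅x, y⁆ = 0 := by
    intro k hk x hx y hy
    have h1 : ⁅x, y⁆ ∈ D (k + 1) := by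
      change ⁅x, y⁆ ∈ LieAlgebra.derivedSeriesOfIdeal ℝ L (k + 1) I
      rw [LieAlgebra.derivedSeriesOfIdeal_succ]
      exact LieSubmodule.lie_mem_lie hx hy
    rw [hk] at h1
    exact (LieSubmodule.mem_bot _).1 h1
  -- An abelian `D (k + 1)` is central, and central elements are orthogonal to all brackets because
  -- `β ⁅x, y⁆ z = β y ⁅s x, z⁆`. Being spanned by brackets, `D (k + 1)` is orthogonal to itself. So
  -- the derived series of the radical already vanishes at step 1.
  have hdesc : ∀ k, D (k + 2) = ⊥ → D (k + 1) = ⊥ := by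
    intro k hk
    rw [LieSubmodule.eq_bot_iff]
    intro z hz
    have hzc : ∀ y, ⁅y, z⁆ = 0 := hcen (D (k + 1)) (hab (k + 1) hk) hz
    have hort : ∀ w ∈ D (k + 1), β w z = 0 := by
      intro w hw
      change w ∈ LieAlgebra.derivedSeriesOfIdeal ℝ L (k + 1) I at hw
      rw [LieAlgebra.derivedSeriesOfIdeal_succ, ← LieSubmodule.mem_toSubmodule,
        LieSubmodule.lieIdeal_oper_eq_linear_span'] at hw
      induction hw using Submodule.span_induction with
      | mem w hw =>
        obtain ⟨x, -, y, -, rfl⟩ := hw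
        rw [hadj, hzc, map_zero]
      | zero => rw [map_zero, LinearMap.zero_apply]
      | add a b _ _ ha hb => rw [map_add, LinearMap.add_apply, ha, hb, add_zero]
      | smul c a _ ha => rw [map_smul, LinearMap.smul_apply, ha, smul_zero]
    by_contra h
    exact (hpos z h).ne' (hort z hz)
  obtain ⟨k, hk⟩ := LieAlgebra.IsSolvable.solvable ℝ I
  rw [LieAlgebra.derivedSeries_def, LieIdeal.derivedSeries_eq_bot_iff] at hk
  have h1 : D 1 = ⊥ := by
    have h2 : ∀ k, D (k + 1) = ⊥ → D 1 = ⊥ := by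
      intro k
      induction k with
      | zero => exact id
      | succ k ih => exact fun h => ih (hdesc k h)
    refine h2 k ?_
    change LieAlgebra.derivedSeriesOfIdeal ℝ L (k + 1) I = ⊥
    rw [LieAlgebra.derivedSeriesOfIdeal_succ, hk]
    exact LieSubmodule.lie_bot _
  refine LieAlgebra.hasCentralRadical_of_radical_le ℝ L fun x hx => ?_
  exact fun y => hcen I (hab 0 h1) hx y

end Reductive

/-- For the inner product `T (τ x * y)`, the adjoint of `ad x` is `ad (τ x)`. -/
theorem IsPositiveTrace.hasCentralRadical {R : Type*} [Ring R] [Algebra ℝ R]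
    [FiniteDimensional ℝ R] {τ : R →ₗ[ℝ] R} {T : R →ₗ[ℝ] ℝ} (h : IsPositiveTrace τ T)
    (L : LieSubalgebra ℝ R) (hL : ∀ x ∈ L, τ x ∈ L) : LieAlgebra.HasCentralRadical ℝ L := by
  have : FiniteDimensional ℝ L := inferInstanceAs (FiniteDimensional ℝ L.toSubmodule)
  let β : LinearMap.BilinForm ℝ L := LinearMap.mk₂ ℝ (fun x y : L => T (τ x * y))
    (fun x y z => by simp [add_mul]) (fun c x y => by simp)
    (fun x y z => by simp [mul_add]) (fun c x y => by simp)
  have hβ : ∀ x y : L, β x y = T (τ x * y) := fun _ _ => rfl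
  refine hasCentralRadical_of_adjoint β (fun x hx => h.pos _ fun h0 => hx (Subtype.ext h0)) ?_
    (fun x => ⟨τ x, hL x x.2⟩) ?_
  · intro x y
    rw [hβ, hβ, ← h.star, h.anti.map_mul, h.anti.involutive]
  · intro x y z
    rw [hβ, hβ]
    simp only [LieSubalgebra.coe_bracket, Ring.lie_def, map_sub, h.anti.map_mul, sub_mul, mul_sub]
    rw [← mul_assoc, ← mul_assoc, mul_assoc (τ (x : R)), h.mul_comm (τ (x : R)), mul_assoc]

/-! ### The groups `Aut(ω)` are real reductive -/

section FormGroups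

variable {A : Type*} [NormedRing A] [NormedAlgebra ℝ A] {σ : A →ₗ[ℝ] A}

theorem sesqForm_apply (Ω : Matrix (Fin 2) (Fin 2) A) (x y : Fin 2 → A) :
    sesqForm σ Ω x y = (fun i => σ (x i)) ⬝ᵥ (Ω *ᵥ y) := rfl

theorem sesqForm_mulVec (hσ : IsAntiInvolution σ) (Ω g h : Matrix (Fin 2) (Fin 2) A)
    (x y : Fin 2 → A) :
    sesqForm σ Ω (g *ᵥ x) (h *ᵥ y) = sesqForm σ (matInvolution σ g * Ω * h) x y := by
  rw [sesqForm_apply, sesqForm_apply]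
  have h1 : (fun i => σ ((g *ᵥ x) i)) = (fun i => σ (x i)) ᵥ* matInvolution σ g := by
    funext i
    simp [Matrix.mulVec, Matrix.vecMul, dotProduct, hσ.map_mul, matInvolution_apply]
  rw [h1, ← Matrix.dotProduct_mulVec, Matrix.mulVec_mulVec, Matrix.mulVec_mulVec, mul_assoc]

theorem sesqForm_single (hσ : IsAntiInvolution σ) (M : Matrix (Fin 2) (Fin 2) A) (i j : Fin 2) :
    sesqForm σ M (Pi.single i 1) (Pi.single j 1) = M i j := by
  rw [sesqForm_apply]
  have h1 : (fun k => σ ((Pi.single i 1 : Fin 2 → A) k)) = Pi.single i 1 := by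
    funext k
    by_cases hk : k = i
    · subst hk; simp [hσ.map_one]
    · simp [hk]
  rw [h1, single_one_dotProduct, Matrix.mulVec_single_one]
  rfl

theorem mem_autGroup_iff (hσ : IsAntiInvolution σ) {Ω : Matrix (Fin 2) (Fin 2) A}
    {g : (Matrix (Fin 2) (Fin 2) A)ˣ} :
    g ∈ autGroup σ Ω ↔ matInvolution σ (g : Matrix (Fin 2) (Fin 2) A) * Ω * g = Ω := by
  constructor
  · intro hg
    ext i j
    have h1 := hg (Pi.single i 1) (Pi.single j 1)
    rwa [sesqForm_mulVec hσ, sesqForm_single hσ, sesqForm_single hσ] at h1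
  · intro hg x y
    rw [sesqForm_mulVec hσ, hg]

theorem mem_endLie_iff_matInvolution (hσ : IsAntiInvolution σ)
    {Ω X : Matrix (Fin 2) (Fin 2) A} :
    X ∈ endLie σ Ω ↔ matInvolution σ X * Ω + Ω * X = 0 := by
  have hone : matInvolution σ (1 : Matrix (Fin 2) (Fin 2) A) = 1 := by
    ext i j
    rw [matInvolution_apply]
    by_cases hij : i = j
    · subst hij; simp [hσ.map_one]
    · simp [hij, Ne.symm hij]
  have key : ∀ x y : Fin 2 → A, sesqForm σ Ω (X *ᵥ x) y + sesqForm σ Ω x (X *ᵥ y) =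
      sesqForm σ (matInvolution σ X * Ω + Ω * X) x y := by
    intro x y
    have h1 := sesqForm_mulVec hσ Ω X 1 x y
    have h2 := sesqForm_mulVec hσ Ω 1 X x y
    rw [Matrix.one_mulVec, mul_one] at h1
    rw [Matrix.one_mulVec, hone, one_mul] at h2
    rw [h1, h2, sesqForm_apply, sesqForm_apply, sesqForm_apply, ← dotProduct_add,
      ← Matrix.add_mulVec]
  constructor
  · intro hX
    ext i j
    have h1 := hX (Pi.single i 1) (Pi.single j 1)
    rwa [key, sesqForm_single hσ] at h1
  · intro hX x y
    rw [key, hX, sesqForm_apply, Matrix.zero_mulVec, dotProduct_zero]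

end FormGroups

section Exp

variable {R : Type*} [NormedRing R] [NormedAlgebra ℝ R] [FiniteDimensional ℝ R]

theorem exp_units_conj_real (u : Rˣ) (x : R) :
    NormedSpace.exp ((u : R) * x * (↑u⁻¹ : R)) = u * NormedSpace.exp x * (↑u⁻¹ : R) := by
  let _ : NormedAlgebra ℚ R := NormedAlgebra.restrictScalars ℚ ℝ R
  have : CompleteSpace R := FiniteDimensional.complete ℝ R
  exact NormedSpace.exp_units_conj u x

theorem expUnit_zpow (x : R) (n : ℤ) : expUnit x ^ n = expUnit ((n : ℝ) • x) := by
  let f : Multiplicative ℝ →* Rˣ :=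
    { toFun := fun t => expUnit (t.toAdd • x)
      map_one' := Units.ext (by simp [expUnit])
      map_mul' := fun s t => Units.ext (by
        simp only [toAdd_mul, add_smul, expUnit, Units.val_mul]
        exact exp_add_of_commute_real (((Commute.refl x).smul_left _).smul_right _)) }
  have h1 : f (Multiplicative.ofAdd 1) = expUnit x := by simp [f]
  have h2 : f (Multiplicative.ofAdd (n : ℝ)) = expUnit ((n : ℝ) • x) := rfl
  rw [← h1, ← h2, ← map_zpow, ← ofAdd_zsmul]
  simp

/-- Compactness of the unit sphere gives `c ‖x‖² ≤ T (τ x * x)` with `c > 0`, so unitary elements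
lie in the ball of radius `√(T 1 / c)`. The units embed openly in `R`, and there the unitary
elements form a closed set. -/
theorem IsPositiveTrace.isCompact_unitary {τ : R →ₗ[ℝ] R} {T : R →ₗ[ℝ] ℝ}
    (h : IsPositiveTrace τ T) : IsCompact {g : Rˣ | τ g * g = 1} := by
  have : ProperSpace R := FiniteDimensional.proper ℝ R
  have : CompleteSpace R := FiniteDimensional.complete ℝ R
  have hτ : Continuous τ := τ.continuous_of_finiteDimensional
  have hT : Continuous T := T.continuous_of_finiteDimensional
  rw [Units.isOpenEmbedding_val.isInducing.isCompact_iff]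
  have himg : (Units.val '' {g : Rˣ | τ g * g = 1}) = {x : R | τ x * x = 1} := by
    ext x
    constructor
    · rintro ⟨g, hg, rfl⟩
      exact hg
    · intro hx
      have : IsNoetherianRing R := IsNoetherianRing.of_finite ℝ R
      exact ⟨⟨x, τ x, IsDedekindFiniteMonoid.mul_eq_one_symm hx, hx⟩, hx, rfl⟩
  rw [himg]
  have hcl : IsClosed {x : R | τ x * x = 1} :=
    isClosed_eq (hτ.mul continuous_id) continuous_const
  have hqc : Continuous fun x : R => T (τ x * x) := hT.comp (hτ.mul continuous_id)
  rcases (Metric.sphere (0 : R) 1).eq_empty_or_nonempty with hS | hS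
  · have hall : ∀ x : R, x = 0 := by
      intro x
      by_contra hx
      have : (‖x‖⁻¹ • x) ∈ Metric.sphere (0 : R) 1 := by
        rw [mem_sphere_zero_iff_norm, norm_smul, norm_inv, norm_norm,
          inv_mul_cancel₀ (norm_ne_zero_iff.2 hx)]
      rw [hS] at this
      exact this
    have : Subsingleton R := ⟨fun a b => (hall a).trans (hall b).symm⟩
    exact (Set.toFinite _).isCompact
  · obtain ⟨x0, hx0, hmin⟩ := (isCompact_sphere (0 : R) 1).exists_isMinOn hS hqc.continuousOn
    set c := T (τ x0 * x0)
    have hc : 0 < c := h.pos x0 fun h0 => by simp [h0] at hx0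
    have hbound : ∀ x, c * ‖x‖ ^ 2 ≤ T (τ x * x) := by
      intro x
      by_cases hx : x = 0
      · simp [hx]
      have hn : ‖x‖ ≠ 0 := norm_ne_zero_iff.2 hx
      have h1 : (‖x‖⁻¹ • x) ∈ Metric.sphere (0 : R) 1 := by
        rw [mem_sphere_zero_iff_norm, norm_smul, norm_inv, norm_norm, inv_mul_cancel₀ hn]
      have h2 : c ≤ T (τ (‖x‖⁻¹ • x) * (‖x‖⁻¹ • x)) := hmin h1
      rw [map_smul, smul_mul_smul_comm, map_smul, smul_eq_mul, ← mul_inv, ← sq,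
        inv_mul_eq_div, le_div_iff₀ (by positivity)] at h2
      exact h2
    refine (isCompact_closedBall (0 : R) (Real.sqrt (T 1 / c))).of_isClosed_subset hcl ?_
    intro x hx
    rw [mem_closedBall_zero_iff]
    refine Real.le_sqrt_of_sq_le ?_
    have h1 := hbound x
    rw [show τ x * x = 1 from hx] at h1
    rwa [le_div_iff₀ hc, _root_.mul_comm]

end Exp

/-! ### Polar decomposition and signed unitary elements -/

/-- `Ω` is unitary and `τ Ω = ± Ω`. -/
structure IsSignedUnitary {R : Type*} [Ring R] [Algebra ℝ R] (τ : R →ₗ[ℝ] R) (Ω : R) : Prop where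
  star_mul : τ Ω * Ω = 1
  mul_star : Ω * τ Ω = 1
  sign : τ Ω = Ω ∨ τ Ω = -Ω

section SignedUnitary

variable {R : Type*} [NormedRing R] [NormedAlgebra ℝ R] {τ : R →ₗ[ℝ] R} {Ω : R}

theorem IsSignedUnitary.star_mem (hΩ : IsSignedUnitary τ Ω) (hτ : IsAntiInvolution τ)
    {X : R} (hX : τ X * Ω + Ω * X = 0) : τ (τ X) * Ω + Ω * τ X = 0 := by
  rw [hτ.involutive]
  have h1 : τ Ω * (τ X * Ω + Ω * X) * τ Ω = 0 := by rw [hX, mul_zero, zero_mul]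
  have h2 : τ Ω * τ X + X * τ Ω = 0 := by
    rw [← h1, mul_add, add_mul, ← mul_assoc, ← mul_assoc, hΩ.star_mul, one_mul, mul_assoc _ Ω,
      hΩ.mul_star, mul_one]
  rcases hΩ.sign with h | h
  · rw [h] at h2
    rwa [add_comm]
  · rw [h, neg_mul, mul_neg, ← neg_add, neg_eq_zero] at h2
    rwa [add_comm]

/-- The relation exhibits `τ Ω * τ g * Ω` as the inverse of `g`; multiplying in the other order
shows that the symmetry group is stable under `τ`. -/
theorem IsSignedUnitary.mul_mul_star (hΩ : IsSignedUnitary τ Ω) {g : Rˣ}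
    (hg : τ g * Ω * g = Ω) : (g : R) * Ω * τ g = Ω := by
  have h1 : τ Ω * τ g * Ω * g = 1 := by
    rw [mul_assoc, mul_assoc, ← mul_assoc (τ (g : R)), hg, hΩ.star_mul]
  have h2 : (g : R) * (τ Ω * τ g * Ω) = 1 := by
    rw [left_inv_eq_right_inv h1 g.mul_inv, Units.mul_inv]
  have h3 : (g : R) * τ Ω * τ g = τ Ω := by
    have h4 := congrArg (· * τ Ω) h2
    simpa only [mul_assoc, hΩ.mul_star, mul_one, one_mul] using h4
  rcases hΩ.sign with h | h
  · rwa [h] at h3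
  · rw [h, mul_neg, neg_mul, neg_inj] at h3
    exact h3

variable [FiniteDimensional ℝ R]

theorem mul_exp_neg_mul_exp (g x : R) :
    g = g * NormedSpace.exp (-x) * NormedSpace.exp x := by
  rw [mul_assoc, exp_neg_mul_exp_real, mul_one]

/-- The element `p = τ g * g` preserves `Ω`, so conjugation by `Ω` sends `p` to `p⁻¹`. Injectivity
of `exp` on symmetric elements turns this into `Ω * X * τ Ω = -X`. -/
theorem IsSignedUnitary.polarLog_mem (hΩ : IsSignedUnitary τ Ω) {T : R →ₗ[ℝ] ℝ}
    (h : IsPositiveTrace τ T) {g : Rˣ} (hg : τ g * Ω * g = Ω) :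
    τ (polarLog τ (g : R)) * Ω + Ω * polarLog τ (g : R) = 0 := by
  obtain ⟨hX, hexp⟩ := h.polarLog_spec g
  set X := polarLog τ (g : R)
  have hg' := hΩ.mul_mul_star hg
  let u : Rˣ := ⟨Ω, τ Ω, hΩ.mul_star, hΩ.star_mul⟩
  have h1 : τ g * g * Ω * (τ g * g) = Ω := by
    calc τ g * g * Ω * (τ g * g) = τ g * ((g : R) * Ω * τ g) * g := by simp only [mul_assoc]
      _ = Ω := by rw [hg', hg]
  have h2 : τ g * g * τ Ω * (τ g * g) = τ Ω := by
    rcases hΩ.sign with hs | hs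
    · rw [hs, h1]
    · rw [hs, mul_neg, neg_mul, h1]
  have h3 : NormedSpace.exp (Ω * ((2 : ℝ) • X) * τ Ω) = Ω * (τ g * g) * τ Ω := by
    rw [← hexp]
    exact exp_units_conj_real u _
  have h4 : NormedSpace.exp (Ω * ((2 : ℝ) • X) * τ Ω) = NormedSpace.exp (-((2 : ℝ) • X)) := by
    refine left_inv_eq_right_inv (a := NormedSpace.exp ((2 : ℝ) • X)) ?_ (exp_mul_exp_neg_real _)
    rw [h3, hexp, mul_assoc Ω, mul_assoc Ω, h2, hΩ.mul_star]
  have hXs : τ ((2 : ℝ) • X) = (2 : ℝ) • X := by rw [map_smul, hX]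
  have h6 := h.isHermitian.exp_injOn h.anti (x := Ω * ((2 : ℝ) • X) * τ Ω)
    (y := -((2 : ℝ) • X)) (by
      rw [h.anti.map_mul, h.anti.map_mul, h.anti.involutive, hXs, mul_assoc])
    (by rw [map_neg, hXs]) h4
  have h7 : (2 : ℝ) • (Ω * X * τ Ω) = (2 : ℝ) • (-X) := by
    rw [smul_neg, ← h6, mul_smul_comm, smul_mul_assoc]
  have h8 : Ω * X * τ Ω = -X := smul_right_injective _ (two_ne_zero (α := ℝ)) h7
  have h9 := congrArg (· * Ω) h8
  simp only [mul_assoc, neg_mul] at h9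
  rw [hΩ.star_mul, mul_one] at h9
  rw [hX, h9, add_neg_cancel]

end SignedUnitary

section RealReductive

variable {A : Type*} [NormedRing A] [NormedAlgebra ℝ A] {σ : A →ₗ[ℝ] A}
  {Ω : Matrix (Fin 2) (Fin 2) A}

theorem cartanInvolution_apply (X : Matrix (Fin 2) (Fin 2) A) :
    cartanInvolution σ X = -matInvolution σ X := rfl

theorem mem_O2_iff (hσ : IsAntiInvolution σ) {g : (Matrix (Fin 2) (Fin 2) A)ˣ} :
    g ∈ O2 σ ↔ matInvolution σ (g : Matrix (Fin 2) (Fin 2) A) * g = 1 := by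
  rw [O2, mem_autGroup_iff hσ, mul_one]

theorem IsSignedUnitary.matInvolution_mem_endLie (hΩ : IsSignedUnitary (matInvolution σ) Ω)
    (hσ : IsAntiInvolution σ) (hτ : IsAntiInvolution (matInvolution σ))
    {X : Matrix (Fin 2) (Fin 2) A} (hX : X ∈ endLie σ Ω) : matInvolution σ X ∈ endLie σ Ω := by
  rw [mem_endLie_iff_matInvolution hσ] at hX ⊢
  exact hΩ.star_mem hτ hX

variable [FiniteDimensional ℝ A]

theorem IsSignedUnitary.isRealReductive (hΩ : IsSignedUnitary (matInvolution σ) Ω)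
    (hσ : IsAntiInvolution σ)
    {T : Matrix (Fin 2) (Fin 2) A →ₗ[ℝ] ℝ} (h : IsPositiveTrace (matInvolution σ) T) :
    IsRealReductive (formGroup σ Ω) (O2 σ ⊓ (formGroup σ Ω).group) (cartanInvolution σ) := by
  have hmem : ∀ X ∈ (formGroup σ Ω).lie, matInvolution σ X ∈ (formGroup σ Ω).lie :=
    fun X hX => hΩ.matInvolution_mem_endLie hσ h.anti hX
  have hexpG : ∀ X ∈ (formGroup σ Ω).lie, expUnit X ∈ (formGroup σ Ω).group := by
    intro X hX
    obtain ⟨g, hg, hg'⟩ := ((formGroup σ Ω).mem_lie_iff X).1 hX 1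
    rw [one_smul] at hg'
    rwa [show expUnit X = g from Units.ext hg'.symm]
  have hpolar : ∀ g ∈ (formGroup σ Ω).group, ∃ k ∈ O2 σ ⊓ (formGroup σ Ω).group,
      ∃ X ∈ (formGroup σ Ω).lie, cartanInvolution σ X = -X ∧
      (g : Matrix (Fin 2) (Fin 2) A) = k * NormedSpace.exp X := by
    intro g hg
    have hX : _ ∈ endLie σ Ω := (mem_endLie_iff_matInvolution hσ).2
      (hΩ.polarLog_mem h ((mem_autGroup_iff hσ).1 hg))
    set X := polarLog (matInvolution σ) (g : Matrix (Fin 2) (Fin 2) A)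
    refine ⟨g * expUnit (-X), ⟨?_, ?_⟩, X, hX, ?_, ?_⟩
    · exact (mem_O2_iff hσ).2 (h.polar_unitary g)
    · exact (formGroup σ Ω).group.mul_mem hg (hexpG _ ((formGroup σ Ω).lie.neg_mem hX))
    · rw [cartanInvolution_apply, (h.polarLog_spec g).1]
    · exact mul_exp_neg_mul_exp _ X
  refine ⟨h.hasCentralRadical _ hmem, inf_le_right, ?_, ?_, ?_, ?_, ?_, ?_, ?_, hpolar, ?_⟩
  · refine h.isCompact_unitary.of_isClosed_subset
      ((isClosed_autGroup σ 1).inter (formGroup σ Ω).isClosed_group) ?_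
    exact fun g hg => (mem_O2_iff hσ).1 hg.1
  -- A compact group containing `K` contains the factor `exp X` of each of its elements, together
  -- with all its powers; these are bounded only if `X = 0`.
  · intro K' hK hK' hcomp
    refine le_antisymm (fun g hg => ?_) hK
    obtain ⟨k, hk, X, hX, hθ, hgk⟩ := hpolar g (hK' hg)
    have hu : expUnit X ∈ K' := by
      have h1 : expUnit X = k⁻¹ * g := by
        rw [eq_inv_mul_iff_mul_eq]
        exact Units.ext hgk.symm
      rw [h1]
      exact K'.mul_mem (K'.inv_mem (hK hk)) hg
    obtain ⟨C, hC⟩ := (hcomp.image Units.continuous_val).isBounded.exists_norm_le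
    have hX0 : X = 0 := by
      refine h.isHermitian.eq_zero_of_bounded_exp h.anti (C := C) ?_ fun n => ?_
      · rw [cartanInvolution_apply, neg_inj] at hθ
        exact hθ
      · refine hC _ ⟨expUnit X ^ n, K'.zpow_mem hu n, ?_⟩
        rw [expUnit_zpow]
        rfl
    rw [hX0, NormedSpace.exp_zero, mul_one] at hgk
    rwa [Units.ext hgk]
  · intro X hX
    exact (formGroup σ Ω).lie.neg_mem (hmem X hX)
  · intro X _
    rw [cartanInvolution_apply, cartanInvolution_apply, map_neg, h.anti.involutive, neg_neg]
  · intro X _ Y _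
    simp only [cartanInvolution_apply, Ring.lie_def, map_sub, h.anti.map_mul, neg_mul_neg]
    abel
  · intro X hX
    have h1 : cartanInvolution σ X = X ↔ X ∈ endLie σ 1 := by
      rw [mem_endLie_iff_matInvolution hσ, mul_one, one_mul, cartanInvolution_apply,
        neg_eq_iff_add_eq_zero]
    rw [h1, mem_endLie_iff]
    have h2 := ((formGroup σ Ω).mem_lie_iff X).1 hX
    refine forall_congr' fun t => ⟨?_, ?_⟩
    · rintro ⟨g, hg, hg'⟩
      obtain ⟨g2, hg2, hg2'⟩ := h2 t
      have : g = g2 := Units.ext (hg'.trans hg2'.symm)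
      exact ⟨g, ⟨hg, this ▸ hg2⟩, hg'⟩
    · rintro ⟨g, hg, hg'⟩
      exact ⟨g, hg.1, hg'⟩
  -- On `𝔨` one has `τ X = -X` and on `𝔪` one has `τ X = X`, so `T (X * X)` equals `∓ T (τ X * X)`
  -- there, which yields the signs.
  · let L := (formGroup σ Ω).lie
    let B : LinearMap.BilinForm ℝ L := LinearMap.mk₂ ℝ
      (fun X Y : L => T ((X : Matrix (Fin 2) (Fin 2) A) * Y))
      (fun x y z => by simp [add_mul]) (fun c x y => by simp)
      (fun x y z => by simp [mul_add]) (fun c x y => by simp)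
    have hB : ∀ X Y : L, B X Y = T ((X : Matrix (Fin 2) (Fin 2) A) * Y) := fun _ _ => rfl
    have hsymm : ∀ X Y : L, B X Y = B Y X := fun X Y => h.mul_comm _ _
    have hsep : ∀ X : L, (∀ Y : L, B X Y = 0) → X = 0 := by
      intro X hX
      by_contra h0
      have h1 := h.pos X fun h1 => h0 (Subtype.ext h1)
      rw [h.mul_comm] at h1
      exact h1.ne' (hX ⟨_, hmem X X.2⟩)
    refine ⟨B, ⟨hsep, fun Y hY => hsep Y fun X => by rw [hsymm]; exact hY X⟩, ⟨hsymm⟩,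
      ?_, ?_, ?_, ?_, ?_⟩
    · intro g X Y
      change T (((g.1 : Matrix (Fin 2) (Fin 2) A) * X * (↑g.1⁻¹ : Matrix (Fin 2) (Fin 2) A)) *
        ((g.1 : Matrix (Fin 2) (Fin 2) A) * Y * (↑g.1⁻¹ : Matrix (Fin 2) (Fin 2) A))) = T (X * Y)
      rw [mul_assoc, ← mul_assoc _ _ (↑g.1⁻¹ : Matrix (Fin 2) (Fin 2) A), ← mul_assoc
        (↑g.1⁻¹ : Matrix (Fin 2) (Fin 2) A), Units.inv_mul, one_mul, mul_assoc, h.mul_comm,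
        mul_assoc, mul_assoc, Units.inv_mul, mul_one]
    · intro X Y X' Y' hX hY
      rw [hB, hB, hX, hY, cartanInvolution_apply, cartanInvolution_apply, neg_mul_neg,
        ← h.anti.map_mul, h.star, h.mul_comm]
    · intro X hX h0
      have h1 := h.pos X fun h1 => h0 (Subtype.ext h1)
      rw [cartanInvolution_apply, neg_eq_iff_eq_neg] at hX
      rw [hX, neg_mul, map_neg] at h1
      rw [hB]
      linarith
    · intro X hX h0
      have h1 := h.pos X fun h1 => h0 (Subtype.ext h1)
      rw [cartanInvolution_apply, neg_inj] at hX
      rwa [hX] at h1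
    · intro X Y hX hY
      rw [cartanInvolution_apply, neg_eq_iff_eq_neg] at hX
      rw [cartanInvolution_apply, neg_inj] at hY
      have h1 : T (X * Y) = -T (X * Y) := by
        conv_lhs => rw [← h.star, h.anti.map_mul, hX, hY, mul_neg, map_neg, h.mul_comm]
      rw [hB]
      linarith
  · have : CompleteSpace (Matrix (Fin 2) (Fin 2) A) := FiniteDimensional.complete ℝ _
    refine ⟨{x | IsUnit x}, polarLog (matInvolution σ), Units.isOpen, ?_, ?_, ?_⟩
    · rintro _ ⟨g, rfl⟩
      exact (h.contDiffAt_polarLog g).contDiffWithinAt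
    · exact fun g _ => g.isUnit
    · intro k hk X _ hθ
      rw [cartanInvolution_apply, neg_inj] at hθ
      exact h.polarLog_mul_exp ((mem_O2_iff hσ).1 hk.1) hθ

end RealReductive

/-! ### Inner automorphisms -/

section Inner

variable {R : Type*} [NormedRing R] [NormedAlgebra ℝ R] [FiniteDimensional ℝ R]

/-- `exp (ad y) = Ad (exp y)` in a finite-dimensional algebra. -/
theorem hasSum_ad_pow (y x : R) :
    HasSum (fun n : ℕ => (n.factorial : ℝ)⁻¹ •
        ((LinearMap.mulLeft ℝ y - LinearMap.mulRight ℝ y) ^ n) x)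
      (NormedSpace.exp y * x * NormedSpace.exp (-y)) := by
  have : CompleteSpace R := FiniteDimensional.complete ℝ R
  let _ : NormedAlgebra ℚ (R →L[ℝ] R) := NormedAlgebra.restrictScalars ℚ ℝ _
  let f : R →L[ℝ] R := LinearMap.toContinuousLinearMap (LinearMap.mulLeft ℝ y)
  let g : R →L[ℝ] R := LinearMap.toContinuousLinearMap (LinearMap.mulRight ℝ (-y))
  have hf : ∀ n : ℕ, ∀ z, (f ^ n) z = y ^ n * z := by
    intro n
    induction n with
    | zero => intro z; simp
    | succ n ih =>
      intro z
      rw [pow_succ, mul_apply_eq_comp, ih, pow_succ, mul_assoc]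
      rfl
  have hg : ∀ n : ℕ, ∀ z, (g ^ n) z = z * (-y) ^ n := by
    intro n
    induction n with
    | zero => intro z; simp
    | succ n ih =>
      intro z
      rw [pow_succ, mul_apply_eq_comp, ih, pow_succ', ← mul_assoc]
      rfl
  -- Left multiplication by `y` commutes with right multiplication by `-y`, so the exponential of
  -- their sum, which is `ad y`, factors.
  have hcomm : Commute f g := by
    ext z
    exact (mul_assoc y z (-y)).symm
  have hexp : ∀ (k : R →L[ℝ] R) (z : R),
      HasSum (fun n : ℕ => (n.factorial : ℝ)⁻¹ • (k ^ n) z) (NormedSpace.exp k z) := by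
    intro k z
    exact (NormedSpace.exp_series_hasSum_exp' (𝕂 := ℝ) k).mapL (ContinuousLinearMap.apply ℝ R z)
  have hf' : ∀ z, NormedSpace.exp f z = NormedSpace.exp y * z := by
    intro z
    refine (hexp f z).unique ?_
    simp only [hf, ← smul_mul_assoc]
    exact (NormedSpace.exp_series_hasSum_exp' (𝕂 := ℝ) y).mul_right z
  have hg' : ∀ z, NormedSpace.exp g z = z * NormedSpace.exp (-y) := by
    intro z
    refine (hexp g z).unique ?_
    simp only [hg, ← mul_smul_comm]
    exact (NormedSpace.exp_series_hasSum_exp' (𝕂 := ℝ) (-y)).mul_left z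
  have h1 := hexp (f + g) x
  rw [NormedSpace.exp_add_of_commute hcomm, mul_apply_eq_comp, hg', hf',
    ← mul_assoc] at h1
  have h2 : ∀ n : ℕ, ∀ z, ((f + g) ^ n) z =
      ((LinearMap.mulLeft ℝ y - LinearMap.mulRight ℝ y) ^ n) z := by
    intro n
    induction n with
    | zero => intro z; rfl
    | succ n ih =>
      intro z
      rw [pow_succ, mul_apply_eq_comp, ih, pow_succ, Module.End.mul_apply]
      congr 1
      change y * z + z * (-y) = y * z - z * y
      rw [mul_neg, sub_eq_add_neg]
  simpa only [h2] using h1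

namespace ClosedLinearGroup

variable (G : ClosedLinearGroup R)

/-- By linearity it suffices to treat pure tensors, on which powers of `ad (1 ⊗ y)` act through
powers of `ad y` on the second factor; there `exp (ad y) = Ad (exp y)` applies. -/
theorem isExpOf_baseChange_Ad {g : G.group} {y : G.lie}
    (hg : (g.1 : R) = NormedSpace.exp (y : R)) :
    IsExpOf (LieAlgebra.ad ℂ (ℂ ⊗[ℝ] G.lie) (1 ⊗ₜ y))
      (LinearEquiv.baseChange ℝ ℂ G.lie G.lie (G.Ad g) : ℂ ⊗[ℝ] G.lie →ₗ[ℂ] ℂ ⊗[ℝ] G.lie) := by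
  have hinv : (↑g.1⁻¹ : R) = NormedSpace.exp (-(y : R)) := by
    refine (left_inv_eq_right_inv ?_ g.1.mul_inv).symm
    rw [hg, exp_neg_mul_exp_real]
  intro v l
  induction v using TensorProduct.induction_on with
  | zero => simp
  | add v w hv hw =>
    simp only [map_add, mul_add]
    exact hv.add hw
  | tmul z x =>
    let ℓ : G.lie →ₗ[ℝ] ℂ := (l.restrictScalars ℝ) ∘ₗ TensorProduct.mk ℝ ℂ G.lie z
    -- The series converges in the ambient algebra `R`, so the functional must be extended beyond
    -- the Lie algebra before it is applied.
    obtain ⟨m, hm⟩ := LinearMap.exists_extend (p := G.lie.toSubmodule) ℓ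
    have hm' : ∀ w : G.lie, m w = l (z ⊗ₜ w) := fun w => LinearMap.congr_fun hm w
    have hpow : ∀ n : ℕ, ((LieAlgebra.ad ℂ (ℂ ⊗[ℝ] G.lie) (1 ⊗ₜ y)) ^ n) (z ⊗ₜ[ℝ] x) =
        z ⊗ₜ ((LieAlgebra.ad ℝ G.lie y) ^ n) x := by
      intro n
      induction n with
      | zero => rfl
      | succ n ih =>
        rw [pow_succ', Module.End.mul_apply, ih, pow_succ', Module.End.mul_apply,
          LieAlgebra.ad_apply, LieAlgebra.ExtendScalars.bracket_tmul, one_mul, LieAlgebra.ad_apply]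
    have hcoe : ∀ n : ℕ, ((((LieAlgebra.ad ℝ G.lie y) ^ n) x : G.lie) : R) =
        ((LinearMap.mulLeft ℝ (y : R) - LinearMap.mulRight ℝ (y : R)) ^ n) x := by
      intro n
      induction n with
      | zero => rfl
      | succ n ih =>
        rw [pow_succ', Module.End.mul_apply, pow_succ', Module.End.mul_apply, ← ih]
        rfl
    have h1 := (hasSum_ad_pow (y : R) (x : R)).mapL (LinearMap.toContinuousLinearMap m)
    simp only [← hcoe, map_smul, LinearMap.coe_toContinuousLinearMap'] at h1
    have h2 : NormedSpace.exp (y : R) * x * NormedSpace.exp (-(y : R)) = (G.Ad g x : R) := by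
      rw [← hinv, ← hg]
      rfl
    rw [h2, hm'] at h1
    have h3 : (LinearEquiv.baseChange ℝ ℂ G.lie G.lie (G.Ad g) :
        ℂ ⊗[ℝ] G.lie →ₗ[ℂ] ℂ ⊗[ℝ] G.lie) (z ⊗ₜ x) = z ⊗ₜ G.Ad g x := rfl
    rw [h3]
    simp only [hpow]
    simp only [hm', Complex.real_smul, Complex.ofReal_inv, Complex.ofReal_natCast] at h1
    exact h1

theorem Ad_mul {g h : Rˣ} (hg : g ∈ G.group) (hh : h ∈ G.group) :
    G.Ad ⟨g * h, G.group.mul_mem hg hh⟩ = G.Ad ⟨g, hg⟩ * G.Ad ⟨h, hh⟩ := by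
  ext x
  simp [Ad, mul_assoc]

/-- The subgroup of elements acting by inner automorphisms on the complexified Lie algebra. -/
def innerSubgroup : Subgroup Rˣ where
  carrier := {g | ∃ hg : g ∈ G.group,
    LinearEquiv.baseChange ℝ ℂ G.lie G.lie (G.Ad ⟨g, hg⟩) ∈ innerAutGroup (ℂ ⊗[ℝ] G.lie)}
  one_mem' := by
    refine ⟨G.group.one_mem, ?_⟩
    have h1 : G.Ad ⟨1, G.group.one_mem⟩ = 1 := by
      ext x
      simp [Ad]
    rw [h1, LinearEquiv.baseChange_one]
    exact (innerAutGroup (ℂ ⊗[ℝ] G.lie)).one_mem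
  mul_mem' := by
    rintro g h ⟨hg, hg'⟩ ⟨hh, hh'⟩
    refine ⟨G.group.mul_mem hg hh, ?_⟩
    rw [G.Ad_mul hg hh, LinearEquiv.baseChange_mul]
    exact (innerAutGroup (ℂ ⊗[ℝ] G.lie)).mul_mem hg' hh'
  inv_mem' := by
    rintro g ⟨hg, hg'⟩
    refine ⟨G.group.inv_mem hg, ?_⟩
    have h1 : G.Ad ⟨g⁻¹, G.group.inv_mem hg⟩ = (G.Ad ⟨g, hg⟩)⁻¹ := by
      rw [eq_inv_iff_mul_eq_one, ← G.Ad_mul (G.group.inv_mem hg) hg]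
      ext x
      simp [Ad]
    rw [h1, LinearEquiv.baseChange_inv]
    exact (innerAutGroup (ℂ ⊗[ℝ] G.lie)).inv_mem hg'

theorem exp_mem_innerSubgroup {y : R} (hy : y ∈ G.lie) : expUnit y ∈ G.innerSubgroup := by
  obtain ⟨g, hg, hg'⟩ := (G.mem_lie_iff y).1 hy 1
  rw [one_smul] at hg'
  have h1 : expUnit y = g := Units.ext hg'.symm
  rw [h1]
  exact ⟨hg, Subgroup.subset_closure ⟨_, G.isExpOf_baseChange_Ad (g := ⟨g, hg⟩) (y := ⟨y, hy⟩) hg'⟩⟩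

end ClosedLinearGroup

/-- A real reductive group is strongly reductive if its maximal compact subgroup acts by inner
automorphisms on the complexified Lie algebra. -/
theorem IsRealReductive.isStronglyReductive {G : ClosedLinearGroup R} {K : Subgroup Rˣ}
    {θ : R →ₗ[ℝ] R} (h : IsRealReductive G K θ) (hK : K ≤ G.innerSubgroup) :
    IsStronglyReductive G K θ where
  isRealReductive := h
  inner := by
    rintro ⟨g, hg⟩
    obtain ⟨k, hk, x, hx, -, hgk⟩ := h.polar_surjective g hg
    have h1 : g = k * expUnit x := Units.ext hgk
    have h2 : g ∈ G.innerSubgroup := h1 ▸ mul_mem (hK hk) (G.exp_mem_innerSubgroup hx)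
    exact h2.2

end Inner

/-! ### Unitary elements as exponentials -/

section Unitary

variable {R : Type*} [NormedRing R] [NormedAlgebra ℝ R] [FiniteDimensional ℝ R]
  {τ : R →ₗ[ℝ] R} {T : R →ₗ[ℝ] ℝ}

omit [FiniteDimensional ℝ R] in
/-- Extension of an algebra homomorphism `ℝⁿ → R` to `ℂⁿ` by an imaginary unit `J` commuting with
its range. -/
theorem exists_algHom_complex {n : ℕ} (φ : (Fin n → ℝ) →ₐ[ℝ] R) {J : R} (hJ : J * J = -1)
    (hφ : ∀ d, φ d * J = J * φ d) : ∃ ψ : (Fin n → ℂ) →ₐ[ℝ] R,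
      ∀ z, ψ z = φ (fun i => (z i).re) + J * φ (fun i => (z i).im) := by
  let f : (Fin n → ℂ) →ₗ[ℝ] R :=
    { toFun := fun z => φ (fun i => (z i).re) + J * φ (fun i => (z i).im)
      map_add' := fun z w => by
        have h1 : (fun i => ((z + w) i).re) = (fun i => (z i).re) + fun i => (w i).re := rfl
        have h2 : (fun i => ((z + w) i).im) = (fun i => (z i).im) + fun i => (w i).im := rfl
        rw [h1, h2, map_add, map_add, mul_add]
        abel
      map_smul' := fun c z => by
        have h1 : (fun i => ((c • z) i).re) = c • fun i => (z i).re := by funext i; simp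
        have h2 : (fun i => ((c • z) i).im) = c • fun i => (z i).im := by funext i; simp
        rw [h1, h2, map_smul, map_smul, mul_smul_comm, RingHom.id_apply, smul_add] }
  have hf : ∀ z, f z = φ (fun i => (z i).re) + J * φ (fun i => (z i).im) := fun _ => rfl
  refine ⟨AlgHom.ofLinearMap f ?_ fun z w => ?_, hf⟩
  · have h1 : (fun i : Fin n => ((1 : Fin n → ℂ) i).re) = 1 := by funext i; simp
    have h2 : (fun i : Fin n => ((1 : Fin n → ℂ) i).im) = 0 := by funext i; simp
    rw [hf, h1, h2, map_one, map_zero, mul_zero, add_zero]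
  · have h1 : (fun i => ((z * w) i).re) = (fun i => (z i).re) * (fun i => (w i).re) -
        (fun i => (z i).im) * fun i => (w i).im := by funext i; simp
    have h2 : (fun i => ((z * w) i).im) = (fun i => (z i).re) * (fun i => (w i).im) +
        (fun i => (z i).im) * fun i => (w i).re := by funext i; simp
    rw [hf, hf, hf, h1, h2, map_sub, map_add, map_mul, map_mul, map_mul, map_mul]
    set a := φ fun i => (z i).re
    set b := φ fun i => (z i).im
    set c := φ fun i => (w i).re
    set d := φ fun i => (w i).im
    have ha : a * J = J * a := hφ _
    have hb : b * J = J * b := hφ _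
    have h3 : a * (J * d) = J * (a * d) := by rw [← mul_assoc, ha, mul_assoc]
    have h4 : J * b * (J * d) = -(b * d) := by
      rw [mul_assoc, ← mul_assoc b, hb, mul_assoc J b, ← mul_assoc J J, hJ, neg_one_mul]
    rw [add_mul, mul_add, mul_add, mul_add (J * b), h3, h4, mul_assoc J b c]
    abel

/-- A unitary element commuting with a skew-symmetric imaginary unit `J` is of the form
`exp (J x)` with `x` symmetric and commuting with `J`. -/
theorem IsHermitianInvolution.exists_exp_imaginary (hH : IsHermitianInvolution τ)
    (hτ : IsAntiInvolution τ) {J : R} (hJ : J * J = -1) (hJτ : τ J = -J) {u : Rˣ}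
    (hu : τ u * u = 1) (huJ : (u : R) * J = J * u) :
    ∃ x, τ x = x ∧ x * J = J * x ∧ (u : R) = NormedSpace.exp (J * x) := by
  have hinv : τ u = (↑u⁻¹ : R) := left_inv_eq_right_inv hu u.mul_inv
  have hu' : (u : R) * τ u = 1 := by rw [hinv, Units.mul_inv]
  have hvJ : τ u * J = J * τ u := by
    have h1 := congrArg τ huJ
    rw [hτ.map_mul, hτ.map_mul, hJτ, neg_mul, mul_neg, neg_inj] at h1
    exact h1.symm
  set v := τ (u : R)
  have hv : τ v = u := hτ.involutive _
  -- With `J` in the role of `i` and `v = u⁻¹`, these are the cosine and sine parts of `u = c + J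
  -- s`: commuting symmetric elements that commute with `J`.
  let c : R := (2 : ℝ)⁻¹ • (u + v)
  let s : R := (2 : ℝ)⁻¹ • (J * (v - u))
  have hcτ : τ c = c := by
    change τ ((2 : ℝ)⁻¹ • (u + v)) = _
    rw [map_smul, map_add, hv, add_comm]
  have hcJ : c * J = J * c := by
    change ((2 : ℝ)⁻¹ • (u + v)) * J = J * ((2 : ℝ)⁻¹ • (u + v))
    rw [smul_mul_assoc, mul_smul_comm, add_mul, mul_add, huJ, hvJ]
  have hvuJ : (v - u) * J = J * (v - u) := by rw [sub_mul, mul_sub, huJ, hvJ]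
  have hsτ : τ s = s := by
    change τ ((2 : ℝ)⁻¹ • (J * (v - u))) = (2 : ℝ)⁻¹ • (J * (v - u))
    rw [map_smul, hτ.map_mul, map_sub, hv, hJτ, mul_neg, ← neg_mul, neg_sub, hvuJ]
  have hsJ : s * J = J * s := by
    change ((2 : ℝ)⁻¹ • (J * (v - u))) * J = J * ((2 : ℝ)⁻¹ • (J * (v - u)))
    rw [smul_mul_assoc, mul_smul_comm, mul_assoc, hvuJ]
  have hcs : c * s = s * c := by
    change ((2 : ℝ)⁻¹ • (u + v)) * ((2 : ℝ)⁻¹ • (J * (v - u))) =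
      ((2 : ℝ)⁻¹ • (J * (v - u))) * ((2 : ℝ)⁻¹ • (u + v))
    have h1 : ((u : R) + v) * J = J * (u + v) := by rw [add_mul, mul_add, huJ, hvJ]
    have h2 : ((u : R) + v) * (v - u) = (v - u) * (u + v) := by
      rw [add_mul, mul_add, mul_sub, mul_sub, sub_mul, sub_mul, hu, hu']
    rw [smul_mul_smul_comm, smul_mul_smul_comm, ← mul_assoc, h1, mul_assoc, h2, mul_assoc]
  have husum : (u : R) = c + J * s := by
    change (u : R) = (2 : ℝ)⁻¹ • (u + v) + J * ((2 : ℝ)⁻¹ • (J * (v - u)))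
    rw [mul_smul_comm, ← mul_assoc, hJ, neg_one_mul, ← smul_add, neg_sub,
      show (u : R) + v + (u - v) = (2 : ℝ) • (u : R) by rw [two_smul]; abel, smul_smul,
      inv_mul_cancel₀ two_ne_zero, one_smul]
  have hcomm : ∀ a ∈ ({c, s} : Set R), ∀ b ∈ ({c, s} : Set R), a * b = b * a := by
    rintro a (rfl | rfl) b (rfl | rfl)
    exacts [rfl, hcs, hcs.symm, rfl]
  have hsym : ∀ a ∈ ({c, s} : Set R), τ a = a := by
    rintro a (rfl | rfl)
    exacts [hcτ, hsτ]
  obtain ⟨n, φ, hφ, hr⟩ := hH.exists_pi_algHom hτ hcomm hsym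
  have hφτ : ∀ d, τ (φ d) = φ d := fun d => hτ.map_eq_of_mem_adjoin hcomm hsym (hr ▸ ⟨d, rfl⟩)
  have hφJ : ∀ d, φ d * J = J * φ d := by
    intro d
    have h1 : φ d ∈ Algebra.adjoin ℝ ({c, s} : Set R) := hr ▸ ⟨d, rfl⟩
    refine (Algebra.commute_of_mem_adjoin_of_forall_mem_commute h1 ?_).symm
    rintro b (rfl | rfl)
    exacts [hcJ.symm, hsJ.symm]
  obtain ⟨a, ha⟩ : c ∈ φ.range := hr ▸ Algebra.subset_adjoin (Set.mem_insert c _)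
  obtain ⟨b, hb⟩ : s ∈ φ.range :=
    hr ▸ Algebra.subset_adjoin (Set.mem_insert_of_mem c (Set.mem_singleton s))
  change φ a = c at ha
  change φ b = s at hb
  -- Unitarity reads `(c - J s)(c + J s) = c² + s² = 1`, so every joint eigenvalue `a i + b i * I`
  -- has modulus one and its argument provides the logarithm.
  have hab : ∀ i, a i * a i + b i * b i = 1 := by
    have h1 : φ (a * a + b * b) = φ 1 := by
      rw [map_add, map_mul, map_mul, map_one, ha, hb, ← hu]
      have h2 : v = c - J * s := by
        have h3 := congrArg τ husum
        rw [map_add, hτ.map_mul, hcτ, hsτ, hJτ, mul_neg, hsJ, ← sub_eq_add_neg] at h3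
        exact h3
      rw [h2, husum, sub_mul, mul_add, mul_add]
      have h4 : J * s * (J * s) = -(s * s) := by
        rw [mul_assoc, ← mul_assoc s, hsJ, mul_assoc J s, ← mul_assoc J J, hJ, neg_one_mul]
      have h5 : J * s * c = c * (J * s) := by rw [mul_assoc, ← hcs, ← mul_assoc, ← hcJ, mul_assoc]
      rw [h4, h5]
      abel
    intro i
    exact congrFun (hφ h1) i
  obtain ⟨ψ, hψ⟩ := exists_algHom_complex φ hJ hφJ
  let z : Fin n → ℂ := fun i => ⟨a i, b i⟩
  refine ⟨φ fun i => (z i).arg, hφτ _, hφJ _, ?_⟩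
  have h1 : J * φ (fun i => (z i).arg) = ψ fun i => (z i).arg * Complex.I := by
    rw [hψ]
    have h2 : (fun i => (((z i).arg : ℂ) * Complex.I).re) = 0 := by funext i; simp
    have h3 : (fun i => (((z i).arg : ℂ) * Complex.I).im) = fun i => (z i).arg := by
      funext i; simp
    rw [h2, h3, map_zero, zero_add]
  have h2 : NormedSpace.exp (fun i => ((z i).arg : ℂ) * Complex.I) = z := by
    funext i
    rw [Pi.exp_def, ← Complex.exp_eq_exp_ℂ]
    have h3 : ‖z i‖ = 1 := by
      rw [← sq_eq_sq₀ (norm_nonneg _) zero_le_one, ← Complex.normSq_eq_norm_sq,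
        Complex.normSq_apply, one_pow]
      exact hab i
    have h4 := Complex.norm_mul_exp_arg_mul_I (z i)
    rwa [h3, Complex.ofReal_one, one_mul] at h4
  rw [h1, ← map_exp_algHom, h2, hψ, husum, ← ha, ← hb]

/-- The group of unitary elements. -/
def isometrySubgroup (hτ : IsAntiInvolution τ) : Subgroup Rˣ where
  carrier := {g | τ g * g = 1}
  one_mem' := by simp [hτ.map_one]
  mul_mem' := by
    intro g h (hg : τ g * g = 1) (hh : τ h * h = 1)
    change τ ((g : R) * h) * (g * h) = 1
    rw [hτ.map_mul, mul_assoc, ← mul_assoc (τ (g : R)), hg, one_mul, hh]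
  inv_mem' := by
    intro g (hg : τ g * g = 1)
    change τ (↑g⁻¹ : R) * (↑g⁻¹ : R) = 1
    have h1 : τ g = (↑g⁻¹ : R) := left_inv_eq_right_inv hg g.mul_inv
    rw [← h1, hτ.involutive, h1, Units.mul_inv]

theorem continuous_expUnit : Continuous (expUnit : R → Rˣ) := by
  have h1 : Continuous (NormedSpace.exp : R → R) := contDiff_exp_real.continuous
  exact Units.continuous_iff.2 ⟨h1, h1.comp continuous_neg⟩

/-- If the unit group is connected, so is the group of unitary elements. -/
theorem IsPositiveTrace.connectedSpace_isometrySubgroup (h : IsPositiveTrace τ T)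
    [ConnectedSpace Rˣ] : ConnectedSpace (isometrySubgroup h.anti) := by
  -- The unitary factor of the polar decomposition is a continuous retraction of the units onto the
  -- unitary group.
  let f : Rˣ → isometrySubgroup h.anti := fun g =>
    ⟨g * expUnit (-polarLog τ (g : R)), h.polar_unitary g⟩
  have hf : Continuous f := by
    refine Continuous.subtype_mk (continuous_id.mul (continuous_expUnit.comp
      (Continuous.neg ?_))) _
    rw [continuous_iff_continuousAt]
    exact fun g => (h.contDiffAt_polarLog g).continuousAt.comp Units.continuous_val.continuousAt
  have hsurj : Function.Surjective f := by
    rintro ⟨u, hu⟩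
    refine ⟨u, Subtype.ext (Units.ext ?_)⟩
    change (u : R) * NormedSpace.exp (-polarLog τ (u : R)) = u
    have h1 := h.polarLog_mul_exp hu (map_zero τ)
    rw [NormedSpace.exp_zero, mul_one] at h1
    rw [h1, neg_zero, NormedSpace.exp_zero, mul_one]
  exact hsurj.connectedSpace hf

/-- Unitary elements near `1` are exponentials of skew-symmetric elements. -/
theorem eventually_exists_skew_log (hτ : IsAntiInvolution τ) :
    ∀ᶠ u : R in nhds 1, τ u * u = 1 → ∃ x, τ x = -x ∧ u = NormedSpace.exp x := by
  obtain ⟨ψ, hψ, hψ0, hright, hleft⟩ := exists_smooth_local_log (R := R) (x := 0)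
    fun y _ => Commute.zero_right y
  rw [NormedSpace.exp_zero] at hψ hψ0 hright
  have hc1 : Filter.Tendsto (fun u => τ (ψ u)) (nhds 1) (nhds 0) := by
    have h1 : ContinuousAt (fun u => τ (ψ u)) 1 :=
      τ.continuous_of_finiteDimensional.continuousAt.comp hψ.continuousAt
    simpa only [ContinuousAt, hψ0, map_zero] using h1
  have hc2 : Filter.Tendsto (fun u => -ψ u) (nhds 1) (nhds 0) := by
    have h1 : ContinuousAt (fun u => -ψ u) 1 := hψ.continuousAt.neg
    simpa only [ContinuousAt, hψ0, neg_zero] using h1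
  filter_upwards [hright, hc1.eventually hleft, hc2.eventually hleft] with u h1 h2 h3 hu
  refine ⟨ψ u, ?_, h1.symm⟩
  -- Both exponentials are inverse to `u`, and both exponents are near `0`, where `exp` is
  -- injective.
  have h4 : NormedSpace.exp (τ (ψ u)) = NormedSpace.exp (-ψ u) := by
    rw [← exp_antiInvolution hτ]
    refine left_inv_eq_right_inv (a := NormedSpace.exp (ψ u)) ?_ (exp_mul_exp_neg_real _)
    rw [h1, hu]
  rw [← h2, h4, h3]

/-- If the unit group is connected, the unitary elements are products of exponentials of
skew-symmetric elements. -/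
theorem IsPositiveTrace.isometrySubgroup_le_closure (h : IsPositiveTrace τ T) [ConnectedSpace Rˣ] :
    isometrySubgroup h.anti ≤ Subgroup.closure {g | ∃ x, τ x = -x ∧ g = expUnit x} := by
  have := h.connectedSpace_isometrySubgroup
  have : CompleteSpace R := FiniteDimensional.complete ℝ R
  set W := Subgroup.closure {g : Rˣ | ∃ x, τ x = -x ∧ g = expUnit x}
  -- An open subgroup is also closed, so in a connected group it is everything.
  have hopen : IsOpen (W.subgroupOf (isometrySubgroup h.anti) : Set (isometrySubgroup h.anti)) := by
    refine Subgroup.isOpen_of_mem_nhds _ (g := 1) ?_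
    have hc : Continuous fun g : isometrySubgroup h.anti => (g.1 : R) :=
      Units.continuous_val.comp continuous_subtype_val
    have h1 : ((1 : isometrySubgroup h.anti).1 : R) = 1 := rfl
    have h2 := hc.tendsto 1
    rw [h1] at h2
    filter_upwards [h2.eventually (eventually_exists_skew_log h.anti)] with g hg
    obtain ⟨x, hx, hgx⟩ := hg g.2
    exact Subgroup.subset_closure ⟨x, hx, Units.ext hgx⟩
  have huniv := IsClopen.eq_univ ⟨Subgroup.isClosed_of_isOpen _ hopen, hopen⟩ ⟨1, one_mem _⟩
  exact fun g hg => (Set.ext_iff.1 huniv ⟨g, hg⟩).2 trivial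

end Unitary

/-! ### The two families -/

section Families

variable {A : Type*} [NormedRing A] [NormedAlgebra ℝ A] {σ : A →ₗ[ℝ] A}

theorem matInvolution_of (a b c d : A) :
    matInvolution σ !![a, b; c, d] = !![σ a, σ c; σ b, σ d] := by
  ext i j
  fin_cases i <;> fin_cases j <;> rfl

theorem matInvolution_symplectic (hσ : IsAntiInvolution σ) :
    matInvolution σ !![0, 1; -1, 0] = -!![0, 1; -1, 0] := by
  rw [matInvolution_of, map_zero, map_neg, hσ.map_one]
  ext i j
  fin_cases i <;> fin_cases j <;> simp

theorem matInvolution_hyperbolic (hσ : IsAntiInvolution σ) :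
    matInvolution σ !![0, 1; 1, 0] = !![0, 1; 1, 0] := by
  rw [matInvolution_of, map_zero, hσ.map_one]

omit [NormedAlgebra ℝ A] in
theorem symplectic_mul_self :
    (!![0, 1; -1, 0] : Matrix (Fin 2) (Fin 2) A) * !![0, 1; -1, 0] = -1 := by
  ext i j
  fin_cases i <;> fin_cases j <;> simp [Matrix.mul_apply]

omit [NormedAlgebra ℝ A] in
theorem hyperbolic_mul_self :
    (!![0, 1; 1, 0] : Matrix (Fin 2) (Fin 2) A) * !![0, 1; 1, 0] = 1 := by
  ext i j
  fin_cases i <;> fin_cases j <;> simp [Matrix.mul_apply]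

theorem isSignedUnitary_symplectic (hσ : IsAntiInvolution σ) :
    IsSignedUnitary (matInvolution σ) !![0, 1; -1, 0] where
  star_mul := by rw [matInvolution_symplectic hσ, neg_mul, symplectic_mul_self, neg_neg]
  mul_star := by rw [matInvolution_symplectic hσ, mul_neg, symplectic_mul_self, neg_neg]
  sign := Or.inr (matInvolution_symplectic hσ)

theorem isSignedUnitary_hyperbolic (hσ : IsAntiInvolution σ) :
    IsSignedUnitary (matInvolution σ) !![0, 1; 1, 0] where
  star_mul := by rw [matInvolution_hyperbolic hσ, hyperbolic_mul_self]
  mul_star := by rw [matInvolution_hyperbolic hσ, hyperbolic_mul_self]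
  sign := Or.inl (matInvolution_hyperbolic hσ)

/-- For unitary `k`, `τ k` is the inverse of `k`, so preserving `Ω` amounts to commuting with it. -/
theorem commute_of_mem_O2_of_mem_autGroup (hσ : IsAntiInvolution σ)
    {Ω : Matrix (Fin 2) (Fin 2) A} {k : (Matrix (Fin 2) (Fin 2) A)ˣ} (hk : k ∈ O2 σ)
    (hk' : k ∈ autGroup σ Ω) :
    (k : Matrix (Fin 2) (Fin 2) A) * Ω = Ω * k := by
  rw [mem_O2_iff hσ] at hk
  rw [mem_autGroup_iff hσ] at hk'
  have h1 : (k : Matrix (Fin 2) (Fin 2) A) * matInvolution σ (k : Matrix (Fin 2) (Fin 2) A) = 1 := by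
    rw [left_inv_eq_right_inv hk k.mul_inv, Units.mul_inv]
  have h2 := congrArg ((k : Matrix (Fin 2) (Fin 2) A) * ·) hk'
  simp only [← mul_assoc] at h2
  rw [h1, one_mul] at h2
  exact h2.symm

theorem prodEmbedding_mul_aux (p q p' q' : A) :
    !![(2 : ℝ)⁻¹ • (p * p' + q * q'), (2 : ℝ)⁻¹ • (p * p' - q * q');
      (2 : ℝ)⁻¹ • (p * p' - q * q'), (2 : ℝ)⁻¹ • (p * p' + q * q')] =
    !![(2 : ℝ)⁻¹ • (p + q), (2 : ℝ)⁻¹ • (p - q); (2 : ℝ)⁻¹ • (p - q), (2 : ℝ)⁻¹ • (p + q)] *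
      !![(2 : ℝ)⁻¹ • (p' + q'), (2 : ℝ)⁻¹ • (p' - q');
        (2 : ℝ)⁻¹ • (p' - q'), (2 : ℝ)⁻¹ • (p' + q')] := by
  rw [Matrix.mul_fin_two]
  simp only [smul_mul_smul_comm, mul_add, add_mul, mul_sub, sub_mul]
  ext i j
  fin_cases i <;> fin_cases j <;> simp <;> module

/-- The embedding `A × A → Mat₂(A)` onto the centralizer of the hyperbolic form. -/
def prodEmbedding (A : Type*) [NormedRing A] [NormedAlgebra ℝ A] :
    A × A →ₐ[ℝ] Matrix (Fin 2) (Fin 2) A :=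
  AlgHom.ofLinearMap
    { toFun := fun p => !![(2 : ℝ)⁻¹ • (p.1 + p.2), (2 : ℝ)⁻¹ • (p.1 - p.2);
        (2 : ℝ)⁻¹ • (p.1 - p.2), (2 : ℝ)⁻¹ • (p.1 + p.2)]
      map_add' := fun p q => by
        ext i j
        fin_cases i <;> fin_cases j <;> simp <;> module
      map_smul' := fun c p => by
        ext i j
        fin_cases i <;> fin_cases j <;> simp <;> module }
    (by
      ext i j
      fin_cases i <;> fin_cases j <;> simp [← two_smul ℝ, smul_smul])
    (fun p q => prodEmbedding_mul_aux p.1 p.2 q.1 q.2)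

theorem prodEmbedding_apply (p : A × A) : prodEmbedding A p =
    !![(2 : ℝ)⁻¹ • (p.1 + p.2), (2 : ℝ)⁻¹ • (p.1 - p.2);
      (2 : ℝ)⁻¹ • (p.1 - p.2), (2 : ℝ)⁻¹ • (p.1 + p.2)] := rfl

theorem prodEmbedding_injective : Function.Injective (prodEmbedding A) := by
  intro p q hpq
  rw [prodEmbedding_apply, prodEmbedding_apply] at hpq
  have h1 : (2 : ℝ)⁻¹ • (p.1 + p.2) = (2 : ℝ)⁻¹ • (q.1 + q.2) := congrFun (congrFun hpq 0) 0
  have h2 : (2 : ℝ)⁻¹ • (p.1 - p.2) = (2 : ℝ)⁻¹ • (q.1 - q.2) := congrFun (congrFun hpq 0) 1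
  refine Prod.ext ?_ ?_
  · calc p.1 = (2 : ℝ)⁻¹ • (p.1 + p.2) + (2 : ℝ)⁻¹ • (p.1 - p.2) := by module
      _ = q.1 := by rw [h1, h2]; module
  · calc p.2 = (2 : ℝ)⁻¹ • (p.1 + p.2) - (2 : ℝ)⁻¹ • (p.1 - p.2) := by module
      _ = q.2 := by rw [h1, h2]; module

theorem matInvolution_prodEmbedding (p : A × A) :
    matInvolution σ (prodEmbedding A p) = prodEmbedding A (σ p.1, σ p.2) := by
  rw [prodEmbedding_apply, matInvolution_of, prodEmbedding_apply]
  simp only [map_smul, map_add, map_sub]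

theorem prodEmbedding_mul_hyperbolic (p : A × A) :
    prodEmbedding A p * !![0, 1; 1, 0] = !![0, 1; 1, 0] * prodEmbedding A p := by
  rw [prodEmbedding_apply, Matrix.mul_fin_two, Matrix.mul_fin_two]
  simp

theorem exists_prodEmbedding_eq {X : Matrix (Fin 2) (Fin 2) A}
    (hX : X * !![0, 1; 1, 0] = !![0, 1; 1, 0] * X) : ∃ p, prodEmbedding A p = X := by
  rw [Matrix.eta_fin_two X, Matrix.mul_fin_two, Matrix.mul_fin_two] at hX
  have h1 := congrFun (congrFun hX 0) 0
  have h2 := congrFun (congrFun hX 0) 1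
  simp at h1 h2
  -- Commuting with the swap gives `X` equal diagonal entries and equal off-diagonal ones; their sum
  -- and difference are the actions of `X` on the `±1` eigenspaces of the swap.
  refine ⟨(X 0 0 + X 0 1, X 0 0 - X 0 1), ?_⟩
  rw [prodEmbedding_apply]
  conv_rhs => rw [Matrix.eta_fin_two X, ← h1, ← h2]
  ext i j
  fin_cases i <;> fin_cases j <;> simp <;> module

variable [FiniteDimensional ℝ A]

/-- Elements of `K` commute with `J = Ω` and hence equal `exp (J x)`, where `J x` lies in the Lie
algebra because `x` is symmetric and commutes with `J`. -/
theorem Sp2_isStronglyReductive {T : A →ₗ[ℝ] ℝ} (h : IsPositiveTrace σ T) :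
    IsStronglyReductive (Sp2 σ) (O2 σ ⊓ (Sp2 σ).group) (cartanInvolution σ) := by
  have hσ := h.anti
  have hT := h.matTrace
  refine ((isSignedUnitary_symplectic hσ).isRealReductive hσ hT).isStronglyReductive ?_
  rintro k ⟨hk, hk'⟩
  obtain ⟨x, hx, hxJ, hkx⟩ := hT.isHermitian.exists_exp_imaginary hT.anti symplectic_mul_self
    (matInvolution_symplectic hσ) ((mem_O2_iff hσ).1 hk)
    (commute_of_mem_O2_of_mem_autGroup hσ hk hk')
  have h1 : k = expUnit (!![0, 1; -1, 0] * x) := Units.ext hkx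
  rw [h1]
  refine ClosedLinearGroup.exp_mem_innerSubgroup _ ?_
  refine (mem_endLie_iff_matInvolution hσ).2 ?_
  rw [hT.anti.map_mul, hx, matInvolution_symplectic hσ, mul_neg, hxJ, neg_mul, mul_assoc, hxJ,
    neg_add_cancel]

theorem prodEmbedding_mem_innerSubgroup (hσ : IsAntiInvolution σ) {x y : A} (hx : σ x = -x)
    (hy : σ y = -y) : expUnit (prodEmbedding A (x, y)) ∈ (O11 σ).innerSubgroup := by
  refine ClosedLinearGroup.exp_mem_innerSubgroup _ ((mem_endLie_iff_matInvolution hσ).2 ?_)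
  rw [matInvolution_prodEmbedding, ← prodEmbedding_mul_hyperbolic, ← add_mul, ← map_add]
  simp [hx, hy, Prod.mk_zero_zero]

/-- `K` consists of pairs of unitary elements of `A`. Each factor is generated by exponentials of
skew elements, and the embedding carries these to exponentials from the Lie algebra. -/
theorem O11_isStronglyReductive {T : A →ₗ[ℝ] ℝ} (h : IsPositiveTrace σ T) [ConnectedSpace Aˣ] :
    IsStronglyReductive (O11 σ) (O2 σ ⊓ (O11 σ).group) (cartanInvolution σ) := by
  have hσ := h.anti
  have hT := h.matTrace
  let _ : NormedAlgebra ℚ A := NormedAlgebra.restrictScalars ℚ ℝ A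
  have : CompleteSpace A := FiniteDimensional.complete ℝ A
  refine ((isSignedUnitary_hyperbolic hσ).isRealReductive hσ hT).isStronglyReductive ?_
  let f₁ : Aˣ →* (Matrix (Fin 2) (Fin 2) A)ˣ :=
    Units.map ((prodEmbedding A : A × A →* Matrix (Fin 2) (Fin 2) A).comp (MonoidHom.inl A A))
  let f₂ : Aˣ →* (Matrix (Fin 2) (Fin 2) A)ˣ :=
    Units.map ((prodEmbedding A : A × A →* Matrix (Fin 2) (Fin 2) A).comp (MonoidHom.inr A A))
  have hf₁ : isometrySubgroup hσ ≤ (O11 σ).innerSubgroup.comap f₁ := by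
    refine h.isometrySubgroup_le_closure.trans ((Subgroup.closure_le _).2 ?_)
    rintro _ ⟨x, hx, rfl⟩
    have h1 : f₁ (expUnit x) = expUnit (prodEmbedding A (x, 0)) := by
      refine Units.ext (Eq.trans (congrArg (prodEmbedding A) ?_)
        (map_exp_algHom (prodEmbedding A) (x, 0)))
      exact Prod.ext (Prod.fst_exp (x, (0 : A))).symm (by rw [Prod.snd_exp, NormedSpace.exp_zero]; rfl)
    change f₁ (expUnit x) ∈ (O11 σ).innerSubgroup
    rw [h1]
    exact prodEmbedding_mem_innerSubgroup hσ hx (by simp)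
  have hf₂ : isometrySubgroup hσ ≤ (O11 σ).innerSubgroup.comap f₂ := by
    refine h.isometrySubgroup_le_closure.trans ((Subgroup.closure_le _).2 ?_)
    rintro _ ⟨x, hx, rfl⟩
    have h1 : f₂ (expUnit x) = expUnit (prodEmbedding A (0, x)) := by
      refine Units.ext (Eq.trans (congrArg (prodEmbedding A) ?_)
        (map_exp_algHom (prodEmbedding A) (0, x)))
      exact Prod.ext (by rw [Prod.fst_exp, NormedSpace.exp_zero]; rfl) (Prod.snd_exp ((0 : A), x)).symm
    change f₂ (expUnit x) ∈ (O11 σ).innerSubgroup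
    rw [h1]
    exact prodEmbedding_mem_innerSubgroup hσ (by simp) hx
  rintro k ⟨hk, hk'⟩
  obtain ⟨⟨u, v⟩, huv⟩ := exists_prodEmbedding_eq
    (commute_of_mem_O2_of_mem_autGroup hσ hk hk')
  have hk2 := (mem_O2_iff hσ).1 hk
  have hk3 : (k : Matrix (Fin 2) (Fin 2) A) * matInvolution σ (k : Matrix (Fin 2) (Fin 2) A) = 1 := by
    rw [left_inv_eq_right_inv hk2 k.mul_inv, Units.mul_inv]
  rw [← huv, matInvolution_prodEmbedding, ← map_mul, ← map_one (prodEmbedding A)] at hk2 hk3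
  have h1 := prodEmbedding_injective hk2
  have h2 := prodEmbedding_injective hk3
  let u' : Aˣ := ⟨u, σ u, congrArg Prod.fst h2, congrArg Prod.fst h1⟩
  let v' : Aˣ := ⟨v, σ v, congrArg Prod.snd h2, congrArg Prod.snd h1⟩
  have hu : f₁ u' ∈ (O11 σ).innerSubgroup := hf₁ (show σ u * u = 1 from congrArg Prod.fst h1)
  have hv : f₂ v' ∈ (O11 σ).innerSubgroup := hf₂ (show σ v * v = 1 from congrArg Prod.snd h1)
  have hkuv : k = f₁ u' * f₂ v' := by
    refine Units.ext ?_
    change (k : Matrix (Fin 2) (Fin 2) A) = prodEmbedding A (u, 1) * prodEmbedding A (1, v)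
    rw [← map_mul, Prod.mk_mul_mk, mul_one, one_mul, huv]
  rw [hkuv]
  exact mul_mem hu hv

end Families

end

theorem mainTheorem11 (A : Type*) [NormedRing A] [NormedAlgebra ℝ A] [FiniteDimensional ℝ A]
    [IsSemisimpleRing A] (σ : A →ₗ[ℝ] A) (hσ : IsAntiInvolution σ)
    (hHerm : IsHermitianInvolution σ) :
    ((∀ a : Aˣ, ∀ x ∈ nonnegElements σ, (a : A) * x * σ a ∈ nonnegElements σ) →
      IsStronglyReductive (Sp2 σ) (O2 σ ⊓ (Sp2 σ).group) (cartanInvolution σ)) ∧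
    (ConnectedSpace Aˣ →
      IsStronglyReductive (O11 σ) (O2 σ ⊓ (O11 σ).group) (cartanInvolution σ)) := by
  refine ⟨fun h => ?_, fun _ => ?_⟩
  · refine Sp2_isStronglyReductive (isPositiveTrace_symTrace hσ hHerm fun a => ?_)
    have h1 := h a 1 ⟨1, hσ.map_one, by simp⟩
    rwa [mul_one] at h1
  · exact O11_isStronglyReductive (isPositiveTrace_symTrace hσ hHerm
      (mul_star_mem_nonnegElements_of_connectedSpace hσ hHerm))
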